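/- Let $M$ be a compact (Hausdorff) smooth manifold without boundary, equipped with a smooth Riemannian metric $\|\cdot\|$, and let $m$ be its normalized Lebesgue measure, that is, the Riemannian volume divided by its total mass. Let $0<\alpha\le 1$ and let $\Gamma$ be a semigroup, under composition, generated by a (finite or infinite) set of maps $f:M\to M$ each of which is * a $C^{1+\alpha}$ local diffeomorphism, i.e. a $C^1$ local diffeomorphism whose derivative, read in charts, is locally $\alpha$-Hölder, and * conformal, i.e. there is a function $a:M\to\mathbb{R}$ such that for every $x\in M$ one has $Df(x)=a(x)\,I(x)$ with $I(x):T_xM\to T_{f(x)}M$ a linear isometry. Assume that the action of $\Gamma$ on $M$ is * backward expanding: for every $x\in M$ there is $h\in\Gamma$ with $\|Dh(x)^{-1}\|<1$, and * backward minimal: for every nonempty open set $U\subset M$ there are finitely many $h_1,\dots,h_k\in\Gamma$ with $M=h_1(U)\cup\dots\cup h_k(U)$. Then the action of $\Gamma$ is ergodic with respect to Lebesgue measure: every Lebesgue measurable set $A\subset M$ with $f(A)\subset A$ for all $f\in\Gamma$ satisfies $m(A)\in\{0,1\}$. -/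

import Mathlib

open Set MeasureTheory Bundle
open scoped Manifold ContDiff Topology NNReal

noncomputable section

namespace ExpandingActions

section Measure

variable {n : ℕ} {M : Type*} [TopologicalSpace M] [ChartedSpace (EuclideanSpace ℝ (Fin n)) M]
  [IsManifold (𝓡 n) ∞ M] [RiemannianBundle (fun x : M => TangentSpace (𝓡 n) x)]

/-- The coordinate vector field `∂ᵢ` of the chart at `x`, at the point with coordinates `y`:
the image of the `i`-th standard basis vector under the differential of the inverse chart. -/
def coordVector (x : M) (y : EuclideanSpace ℝ (Fin n)) (i : Fin n) :
    TangentSpace (𝓡 n) ((extChartAt (𝓡 n) x).symm y) :=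
  mfderiv 𝓘(ℝ, EuclideanSpace ℝ (Fin n)) (𝓡 n) (extChartAt (𝓡 n) x).symm y
    (EuclideanSpace.single i (1 : ℝ) : EuclideanSpace ℝ (Fin n))

/-- The matrix `gᵢⱼ` of the Riemannian metric in the chart at `x`. -/
def metricMatrix (x : M) (y : EuclideanSpace ℝ (Fin n)) : Matrix (Fin n) (Fin n) ℝ :=
  Matrix.of fun i j => inner ℝ (coordVector x y i) (coordVector x y j)

variable [MeasurableSpace M]

/-- The Riemannian volume of the domain of the chart at `x`: the measure `√(det g) dy` on the image
of the chart, transported to `M`. -/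
def chartVolume (x : M) : Measure M :=
  (((volume : Measure (EuclideanSpace ℝ (Fin n))).restrict (extChartAt (𝓡 n) x).target).withDensity
    fun y => ENNReal.ofReal √(metricMatrix x y).det).map (extChartAt (𝓡 n) x).symm

variable (n M) in
/-- The Riemannian volume. The measures `chartVolume x` agree on the overlaps of the charts, so
that their least upper bound is the measure which restricts to `chartVolume x` on the domain of
the chart at `x`, for every `x`. -/
def riemannianVolume : Measure M := ⨆ x : M, chartVolume (n := n) x

variable (n M) in
/-- The normalized Lebesgue measure: the Riemannian volume divided by its total mass. -/
def lebesgue : Measure M := (riemannianVolume n M univ)⁻¹ • riemannianVolume n M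

end Measure

section Maps

variable {n : ℕ} {M : Type*} [TopologicalSpace M] [ChartedSpace (EuclideanSpace ℝ (Fin n)) M]
  [IsManifold (𝓡 n) ∞ M]

variable (n) in
/-- `C^{1+α}` local diffeomorphisms: `C¹` local diffeomorphisms whose derivative, read in charts, is
locally `α`-Hölder. -/
def IsHolderLocalDiffeo (α : ℝ≥0) (f : M → M) : Prop :=
  IsLocalDiffeomorph (𝓡 n) (𝓡 n) 1 f ∧
  ∀ x : M, ∃ C : ℝ≥0, ∃ U ∈ 𝓝 (extChartAt (𝓡 n) x x),
    HolderOnWith C α (fderiv ℝ (writtenInExtChartAt (𝓡 n) (𝓡 n) x f)) U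

variable [RiemannianBundle (fun x : M => TangentSpace (𝓡 n) x)]

variable (n) in
/-- Conformal maps: `Df(x)` is a scalar `a(x)` times a linear isometry. -/
def IsConformal (f : M → M) : Prop :=
  ∃ a : M → ℝ, ∀ x : M, ∃ L : TangentSpace (𝓡 n) x ≃ₗᵢ[ℝ] TangentSpace (𝓡 n) (f x),
    ∀ v : TangentSpace (𝓡 n) x, mfderiv (𝓡 n) (𝓡 n) f x v = a x • L v

variable (n) in
/-- Every point `x` has some `h ∈ Γ` with `‖Dh(x)⁻¹‖ < 1`. -/
def BackwardExpanding (Γ : Subsemigroup (Function.End M)) : Prop :=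
  ∀ x : M, ∃ h ∈ Γ, ‖(mfderiv (𝓡 n) (𝓡 n) (h : M → M) x).inverse‖ < 1

variable (n) in
/-- Every measurable set `A` with `f(A) ⊆ A` for all `f ∈ Γ` has measure `0` or `1`. -/
def LebesgueErgodic [MeasurableSpace M] (Γ : Subsemigroup (Function.End M)) : Prop :=
  ∀ A : Set M, NullMeasurableSet A (lebesgue n M) → (∀ f ∈ Γ, (f : M → M) '' A ⊆ A) →
    lebesgue n M A = 0 ∨ lebesgue n M A = 1

end Maps

/-- `M` is covered by finitely many images `h(U)`, `h ∈ Γ`, of any nonempty open set `U`. -/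
def BackwardMinimal {M : Type*} [TopologicalSpace M] (Γ : Subsemigroup (Function.End M)) : Prop :=
  ∀ U : Set M, IsOpen U → U.Nonempty →
    ∃ F : Set (Function.End M), F.Finite ∧ (∀ h ∈ F, h ∈ Γ) ∧ ⋃ h ∈ F, (h : M → M) '' U = univ

end ExpandingActions

end

open Filter Manifold Metric
open scoped ENNReal

namespace ExpandingActions

section LengthEstimates

variable {E : Type*} [NormedAddCommGroup E] [NormedSpace ℝ E]
  {H : Type*} [TopologicalSpace H] {I : ModelWithCorners ℝ E H}
  {X : Type*} [PseudoEMetricSpace X] [ChartedSpace H X]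
  [RiemannianBundle (fun x : X => TangentSpace I x)] [IsRiemannianManifold I X]
  {F : Type*} [NormedAddCommGroup F] [NormedSpace ℝ F]
  {G : Type*} [TopologicalSpace G] {J : ModelWithCorners ℝ F G}
  {Y : Type*} [PseudoEMetricSpace Y] [ChartedSpace G Y]
  [RiemannianBundle (fun y : Y => TangentSpace J y)] [IsRiemannianManifold J Y]

/-- A `C¹` map whose differential is bounded by `K` on a ball expands the distance to the centre
by a factor at most `K`. -/
lemma edist_le_of_enorm_mfderiv_le {f : X → Y} {x z : X} {R : ℝ≥0∞} {K : ℝ≥0}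
    (hf : ContMDiffOn I J 1 f (eball x R))
    (hK : ∀ w ∈ eball x R, ∀ v : TangentSpace I w, ‖mfderiv I J f w v‖ₑ ≤ K * ‖v‖ₑ)
    (hz : z ∈ eball x R) : edist (f x) (f z) ≤ K * edist x z := by
  have key : ∀ c, edist x z < c → c ≤ R → edist (f x) (f z) ≤ K * c := by
    intro c hc hcR
    rw [IsRiemannianManifold.out (I := I) x z] at hc
    obtain ⟨γ, γ0, γ1, γs, hγ⟩ := exists_lt_of_riemannianEDist_lt hc
    have hmem : ∀ t ∈ Icc (0 : ℝ) 1, γ t ∈ eball x R := by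
      intro t ht
      rw [mem_eball, edist_comm, IsRiemannianManifold.out (I := I)]
      calc riemannianEDist I x (γ t) ≤ pathELength I γ 0 t :=
            riemannianEDist_le_pathELength (γs.mono (Icc_subset_Icc le_rfl ht.2)) γ0 rfl ht.1
        _ ≤ pathELength I γ 0 1 := pathELength_mono le_rfl ht.2
        _ < R := hγ.trans_le hcR
    rw [IsRiemannianManifold.out (I := J)]
    calc riemannianEDist J (f x) (f z) ≤ pathELength J (f ∘ γ) 0 1 :=
          riemannianEDist_le_pathELength (hf.comp γs hmem) (by simp [γ0]) (by simp [γ1]) zero_le_one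
      _ ≤ K * pathELength I γ 0 1 := by
          rw [pathELength_eq_lintegral_mfderivWithin_Icc,
            pathELength_eq_lintegral_mfderivWithin_Icc,
            ← lintegral_const_mul' _ _ ENNReal.coe_ne_top]
          refine setLIntegral_mono' measurableSet_Icc fun t ht => ?_
          have h1 : mfderivWithin 𝓘(ℝ, ℝ) J (f ∘ γ) (Icc 0 1) t =
              (mfderiv I J f (γ t)) ∘L (mfderivWithin 𝓘(ℝ, ℝ) I γ (Icc 0 1) t) := by
            apply mfderiv_comp_mfderivWithin
            · exact ((hf _ (hmem t ht)).contMDiffAt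
                (isOpen_eball.mem_nhds (hmem t ht))).mdifferentiableAt one_ne_zero
            · exact γs.mdifferentiableOn one_ne_zero t ht
            · rw [uniqueMDiffWithinAt_iff_uniqueDiffWithinAt]
              exact uniqueDiffOn_Icc zero_lt_one t ht
          have h2 : mfderivWithin 𝓘(ℝ, ℝ) J (f ∘ γ) (Icc 0 1) t 1 =
              (mfderiv I J f (γ t)) (mfderivWithin 𝓘(ℝ, ℝ) I γ (Icc 0 1) t 1) := congr($h1 1)
          rw [h2]
          exact hK _ (hmem t ht) _
      _ ≤ K * c := by gcongr
  have hz' : edist x z < R := by rwa [mem_eball, edist_comm] at hz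
  have : Tendsto (fun c : ℝ≥0∞ => K * c) (𝓝[>] (edist x z)) (𝓝 (K * edist x z)) :=
    (ENNReal.Tendsto.const_mul tendsto_id (Or.inr ENNReal.coe_ne_top)).mono_left inf_le_left
  have hne : (𝓝[>] (edist x z)).NeBot := nhdsGT_neBot_of_exists_gt ⟨R, hz'⟩
  refine ge_of_tendsto this ?_
  filter_upwards [Ioo_mem_nhdsGT hz'] with c hc
  exact key c hc.1 hc.2.le

/-- A `C¹` map whose differential is bounded by `K` on a ball is `K`-Lipschitz on the ball of a
third of the radius. -/
lemma lipschitzOnWith_of_enorm_mfderiv_le {f : X → Y} {x : X} {R r : ℝ≥0∞} {K : ℝ≥0}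
    (hf : ContMDiffOn I J 1 f (eball x R))
    (hK : ∀ w ∈ eball x R, ∀ v : TangentSpace I w, ‖mfderiv I J f w v‖ₑ ≤ K * ‖v‖ₑ)
    (hr : 3 * r ≤ R) : LipschitzOnWith K f (eball x r) := by
  intro z hz z' hz'
  have hsub : eball z (2 * r) ⊆ eball x R := by
    intro w hw
    rw [mem_eball] at *
    calc edist w x ≤ edist w z + edist z x := edist_triangle _ _ _
      _ < 2 * r + r := ENNReal.add_lt_add hw hz
      _ = 3 * r := by ring
      _ ≤ R := hr
  refine edist_le_of_enorm_mfderiv_le (hf.mono hsub) (fun w hw => hK w (hsub hw)) ?_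
  rw [mem_eball] at *
  calc edist z' z ≤ edist z' x + edist z x := edist_triangle_right _ _ _
    _ < r + r := ENNReal.add_lt_add hz' hz
    _ = 2 * r := by ring

end LengthEstimates

section Charts

variable {n : ℕ} {M : Type*} [PseudoEMetricSpace M] [ChartedSpace (EuclideanSpace ℝ (Fin n)) M]
  [IsManifold (𝓡 n) ∞ M] [RiemannianBundle (fun x : M => TangentSpace (𝓡 n) x)]
  [IsContinuousRiemannianBundle (EuclideanSpace ℝ (Fin n)) (fun x : M => TangentSpace (𝓡 n) x)]

section TangentNorm

attribute [local instance] normedAddCommGroupTangentSpaceVectorSpace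
  normedSpaceTangentSpaceVectorSpace

variable (n) in
lemma eventually_norm_mfderiv_extChartAt_apply_le (x : M) :
    ∃ C : ℝ≥0, ∀ᶠ y in 𝓝 x, ∀ v : TangentSpace (𝓡 n) y,
      @norm (EuclideanSpace ℝ (Fin n)) _
        (mfderiv (𝓡 n) 𝓘(ℝ, EuclideanSpace ℝ (Fin n)) (extChartAt (𝓡 n) x) y v) ≤ C * ‖v‖ := by
  obtain ⟨C, C_pos, hC⟩ := eventually_norm_mfderiv_extChartAt_lt (𝓡 n) x
  lift C to ℝ≥0 using C_pos.le
  refine ⟨C, ?_⟩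
  filter_upwards [hC] with y hy v
  exact (ContinuousLinearMap.le_opNorm
    (mfderiv (𝓡 n) 𝓘(ℝ, EuclideanSpace ℝ (Fin n)) (extChartAt (𝓡 n) x) y) v).trans
    (mul_le_mul_of_nonneg_right hy.le (norm_nonneg v))

variable (n) in
lemma eventually_norm_mfderiv_extChartAt_symm_apply_le (x : M) :
    ∃ C : ℝ≥0, ∀ᶠ y in 𝓝 (extChartAt (𝓡 n) x x), ∀ v : EuclideanSpace ℝ (Fin n),
      ‖mfderiv 𝓘(ℝ, EuclideanSpace ℝ (Fin n)) (𝓡 n) (extChartAt (𝓡 n) x).symm y v‖ ≤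
        C * ‖v‖ := by
  obtain ⟨C, C_pos, hC⟩ := eventually_norm_mfderivWithin_symm_extChartAt_lt (𝓡 n) x
  simp only [ModelWithCorners.range_eq_univ, nhdsWithin_univ, mfderivWithin_univ] at hC
  lift C to ℝ≥0 using C_pos.le
  refine ⟨C, ?_⟩
  filter_upwards [hC] with y hy v
  exact (ContinuousLinearMap.le_opNorm
    (mfderiv 𝓘(ℝ, EuclideanSpace ℝ (Fin n)) (𝓡 n) (extChartAt (𝓡 n) x).symm y) v).trans
    (mul_le_mul_of_nonneg_right hy.le (norm_nonneg (E := EuclideanSpace ℝ (Fin n)) v))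

end TangentNorm

variable [IsRiemannianManifold (𝓡 n) M]

lemma enorm_le_coe_mul_enorm {E F : Type*} [SeminormedAddCommGroup E] [SeminormedAddCommGroup F]
    {C : ℝ≥0} {v : E} {w : F} (h : ‖v‖ ≤ C * ‖w‖) : ‖v‖ₑ ≤ C * ‖w‖ₑ := by
  simp only [enorm]
  exact_mod_cast h

variable (n) in
lemma exists_lipschitzOnWith_extChartAt (x : M) :
    ∃ K : ℝ≥0, ∃ U ∈ 𝓝 x, LipschitzOnWith K (extChartAt (𝓡 n) x) U := by
  obtain ⟨C, hC⟩ := eventually_norm_mfderiv_extChartAt_apply_le n x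
  obtain ⟨R, R_pos, hR⟩ := EMetric.mem_nhds_iff.1
    (inter_mem hC (chart_source_mem_nhds (EuclideanSpace ℝ (Fin n)) x))
  refine ⟨C, eball x (R / 3), eball_mem_nhds _ (ENNReal.div_pos R_pos.ne' (by simp)), ?_⟩
  refine lipschitzOnWith_of_enorm_mfderiv_le (I := 𝓡 n)
    (J := 𝓘(ℝ, EuclideanSpace ℝ (Fin n))) (R := R) ?_ ?_ ?_
  · exact contMDiffOn_extChartAt.mono fun z hz => (hR hz).2
  · intro w hw v
    have h1 := enorm_le_coe_mul_enorm (E := EuclideanSpace ℝ (Fin n)) ((hR hw).1 v)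
    exact (enorm_tangentSpace_vectorSpace (F := EuclideanSpace ℝ (Fin n))).trans_le h1
  · rw [ENNReal.mul_div_cancel (by simp) (by simp)]

variable (n) in
lemma exists_lipschitzOnWith_extChartAt_symm (x : M) :
    ∃ K : ℝ≥0, ∃ U ∈ 𝓝 (extChartAt (𝓡 n) x x),
      LipschitzOnWith K (extChartAt (𝓡 n) x).symm U := by
  obtain ⟨C, hC⟩ := eventually_norm_mfderiv_extChartAt_symm_apply_le n x
  obtain ⟨R, R_pos, hR⟩ := EMetric.mem_nhds_iff.1
    (inter_mem hC (extChartAt_target_mem_nhds (I := 𝓡 n) x))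
  refine ⟨C, eball _ (R / 3), eball_mem_nhds _ (ENNReal.div_pos R_pos.ne' (by simp)), ?_⟩
  refine lipschitzOnWith_of_enorm_mfderiv_le (J := 𝓡 n)
    (I := 𝓘(ℝ, EuclideanSpace ℝ (Fin n))) (R := R) ?_ ?_ ?_
  · exact (contMDiffOn_extChartAt_symm x).mono fun z hz => (hR hz).2
  · intro w hw v
    have h1 := enorm_le_coe_mul_enorm ((hR hw).1 v)
    refine h1.trans_eq ?_
    congr 1
    exact (enorm_tangentSpace_vectorSpace (F := EuclideanSpace ℝ (Fin n))).symm
  · rw [ENNReal.mul_div_cancel (by simp) (by simp)]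

/-- A map into a normed space which is `C¹` at a point is Lipschitz around this point, for the
Riemannian distance. -/
lemma exists_lipschitzOnWith_of_contMDiffAt_normedSpace {F : Type*} [NormedAddCommGroup F]
    [NormedSpace ℝ F] {f : M → F} {x : M} (hf : ContMDiffAt (𝓡 n) 𝓘(ℝ, F) 1 f x) :
    ∃ K : ℝ≥0, ∃ U ∈ 𝓝 x, LipschitzOnWith K f U := by
  obtain ⟨K, U, hU, hK⟩ := exists_lipschitzOnWith_extChartAt n x
  have h1 : ContDiffAt ℝ 1 (f ∘ (extChartAt (𝓡 n) x).symm) (extChartAt (𝓡 n) x x) := by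
    rw [← contMDiffAt_iff_contDiffAt]
    refine ContMDiffAt.comp _ (by simpa using hf) ?_
    exact (contMDiffOn_extChartAt_symm x).contMDiffAt (extChartAt_target_mem_nhds x)
  obtain ⟨K', V, hV, hK'⟩ := h1.exists_lipschitzOnWith
  have hV' : extChartAt (𝓡 n) x ⁻¹' V ∈ 𝓝 x := (continuousAt_extChartAt x).preimage_mem_nhds hV
  refine ⟨K' * K, (U ∩ extChartAt (𝓡 n) x ⁻¹' V) ∩ (extChartAt (𝓡 n) x).source,
    inter_mem (inter_mem hU hV') (extChartAt_source_mem_nhds x), ?_⟩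
  have h2 := hK'.comp (hK.mono (inter_subset_left.trans inter_subset_left :
    (U ∩ extChartAt (𝓡 n) x ⁻¹' V) ∩ (extChartAt (𝓡 n) x).source ⊆ U)) (fun z hz => hz.1.2)
  intro z hz z' hz'
  simpa only [Function.comp_apply, (extChartAt (𝓡 n) x).left_inv hz.2,
    (extChartAt (𝓡 n) x).left_inv hz'.2] using h2 hz hz'

/-- A `C¹` map is locally Lipschitz for the Riemannian distance. -/
lemma exists_lipschitzOnWith_of_contMDiffAt {f : M → M} {x : M}
    (hf : ContMDiffAt (𝓡 n) (𝓡 n) 1 f x) : ∃ K : ℝ≥0, ∃ U ∈ 𝓝 x, LipschitzOnWith K f U := by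
  obtain ⟨K, V, hV, hK⟩ := exists_lipschitzOnWith_extChartAt_symm n (f x)
  have h1 : ContMDiffAt (𝓡 n) 𝓘(ℝ, EuclideanSpace ℝ (Fin n)) 1 (extChartAt (𝓡 n) (f x) ∘ f) x :=
    ContMDiffAt.comp x contMDiffAt_extChartAt hf
  obtain ⟨K', U, hU, hK'⟩ := exists_lipschitzOnWith_of_contMDiffAt_normedSpace h1
  have hV' : (extChartAt (𝓡 n) (f x) ∘ f) ⁻¹' V ∈ 𝓝 x := h1.continuousAt.preimage_mem_nhds hV
  have hS : f ⁻¹' (extChartAt (𝓡 n) (f x)).source ∈ 𝓝 x :=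
    hf.continuousAt.preimage_mem_nhds (extChartAt_source_mem_nhds _)
  refine ⟨K * K', (U ∩ (extChartAt (𝓡 n) (f x) ∘ f) ⁻¹' V) ∩
    f ⁻¹' (extChartAt (𝓡 n) (f x)).source, inter_mem (inter_mem hU hV') hS, ?_⟩
  have h2 := hK.comp (hK'.mono (inter_subset_left.trans inter_subset_left :
    (U ∩ (extChartAt (𝓡 n) (f x) ∘ f) ⁻¹' V) ∩ f ⁻¹' (extChartAt (𝓡 n) (f x)).source ⊆ U))
    (fun z hz => hz.1.2)
  intro z hz z' hz'
  simpa only [Function.comp_apply, (extChartAt (𝓡 n) (f x)).left_inv hz.2,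
    (extChartAt (𝓡 n) (f x)).left_inv hz'.2] using h2 hz hz'

end Charts

section Coordinates

variable {n : ℕ} {M : Type*} [TopologicalSpace M] [ChartedSpace (EuclideanSpace ℝ (Fin n)) M]
  [IsManifold (𝓡 n) ∞ M]

lemma symmL_fderiv_writtenInExtChartAt {f : M → M} {x z : M}
    (hz : z ∈ (chartAt (EuclideanSpace ℝ (Fin n)) x).source)
    (hfz : f z ∈ (chartAt (EuclideanSpace ℝ (Fin n)) (f x)).source)
    (hf : MDifferentiableAt (𝓡 n) (𝓡 n) f z) (v : EuclideanSpace ℝ (Fin n)) :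
    (trivializationAt (EuclideanSpace ℝ (Fin n)) (TangentSpace (𝓡 n)) (f x)).symmL ℝ (f z)
      (fderiv ℝ (writtenInExtChartAt (𝓡 n) (𝓡 n) x f) (extChartAt (𝓡 n) x z) v) =
    mfderiv (𝓡 n) (𝓡 n) f z
      ((trivializationAt (EuclideanSpace ℝ (Fin n)) (TangentSpace (𝓡 n)) x).symmL ℝ z v) := by
  let e : ∀ x : M, _ := fun x =>
    trivializationAt (EuclideanSpace ℝ (Fin n)) (TangentSpace (𝓡 n) (M := M)) x
  have hzz : (extChartAt (𝓡 n) x).symm (extChartAt (𝓡 n) x z) = z :=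
    (extChartAt (𝓡 n) x).left_inv (by simpa using hz)
  have h1 : HasMFDerivAt 𝓘(ℝ, EuclideanSpace ℝ (Fin n)) (𝓡 n) (extChartAt (𝓡 n) x).symm
      (extChartAt (𝓡 n) x z) ((e x).symmL ℝ z) := by
    rw [TangentBundle.symmL_trivializationAt hz]
    have := (mdifferentiableWithinAt_extChartAt_symm (I := 𝓡 n) (x := x)
      (z := extChartAt (𝓡 n) x z) ((extChartAt (𝓡 n) x).map_source (by simpa using hz)))
    rw [ModelWithCorners.range_eq_univ, mdifferentiableWithinAt_univ] at this
    rw [ModelWithCorners.range_eq_univ, mfderivWithin_univ]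
    exact this.hasMFDerivAt
  have h3 : HasMFDerivAt (𝓡 n) 𝓘(ℝ, EuclideanSpace ℝ (Fin n)) (extChartAt (𝓡 n) (f x)) (f z)
      ((e (f x)).continuousLinearMapAt ℝ (f z)) := by
    rw [TangentBundle.continuousLinearMapAt_trivializationAt hfz]
    exact (mdifferentiableAt_extChartAt hfz).hasMFDerivAt
  have h2 : ∀ w, w = z → HasMFDerivAt (𝓡 n) 𝓘(ℝ, EuclideanSpace ℝ (Fin n))
      (extChartAt (𝓡 n) (f x) ∘ f) w
      (((e (f x)).continuousLinearMapAt ℝ (f z)).comp (mfderiv (𝓡 n) (𝓡 n) f z)) := by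
    rintro _ rfl
    exact h3.comp _ hf.hasMFDerivAt
  have h4 : HasMFDerivAt 𝓘(ℝ, EuclideanSpace ℝ (Fin n)) 𝓘(ℝ, EuclideanSpace ℝ (Fin n))
      (writtenInExtChartAt (𝓡 n) (𝓡 n) x f) (extChartAt (𝓡 n) x z) _ :=
    HasMFDerivAt.comp (g := extChartAt (𝓡 n) (f x) ∘ f) _ (h2 _ hzz) h1
  have h5 : fderiv ℝ (writtenInExtChartAt (𝓡 n) (𝓡 n) x f) (extChartAt (𝓡 n) x z) v =
      (e (f x)).continuousLinearMapAt ℝ (f z)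
        (mfderiv (𝓡 n) (𝓡 n) f z ((e x).symmL ℝ z v)) :=
    calc _ = mfderiv 𝓘(ℝ, EuclideanSpace ℝ (Fin n)) 𝓘(ℝ, EuclideanSpace ℝ (Fin n))
          (writtenInExtChartAt (𝓡 n) (𝓡 n) x f) (extChartAt (𝓡 n) x z) v := by
            rw [mfderiv_eq_fderiv]; rfl
      _ = _ := congr($(h4.mfderiv) v)
  rw [h5]
  exact Bundle.Trivialization.symmL_continuousLinearMapAt _ (by simpa using hfz) _

variable [RiemannianBundle (fun x : M => TangentSpace (𝓡 n) x)]
  [IsContMDiffRiemannianBundle (𝓡 n) ∞ (EuclideanSpace ℝ (Fin n))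
    (fun x : M => TangentSpace (𝓡 n) x)]

/-- The squared Riemannian norm is a `C¹` function of the coordinates of a tangent vector. -/
lemma contDiffAt_sq_norm_symmL (x : M) (u : EuclideanSpace ℝ (Fin n)) :
    ContDiffAt ℝ 1 (fun p : EuclideanSpace ℝ (Fin n) × EuclideanSpace ℝ (Fin n) =>
      ‖(trivializationAt (EuclideanSpace ℝ (Fin n)) (TangentSpace (𝓡 n)) x).symmL ℝ
        ((extChartAt (𝓡 n) x).symm p.1) p.2‖ ^ 2) (extChartAt (𝓡 n) x x, u) := by
  rw [← contMDiffAt_iff_contDiffAt]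
  have hbase : ContMDiffAt 𝓘(ℝ, EuclideanSpace ℝ (Fin n) × EuclideanSpace ℝ (Fin n)) (𝓡 n) 1
      (fun p => (extChartAt (𝓡 n) x).symm p.1) (extChartAt (𝓡 n) x x, u) := by
    refine ContMDiffAt.comp (I' := 𝓘(ℝ, EuclideanSpace ℝ (Fin n))) _
      ((contMDiffOn_extChartAt_symm x).contMDiffAt
        (extChartAt_target_mem_nhds (I := 𝓡 n) x)) ?_
    exact contMDiffAt_iff_contDiffAt.2 contDiffAt_fst
  have hsrc : ∀ᶠ p in 𝓝 (extChartAt (𝓡 n) x x, u),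
      (extChartAt (𝓡 n) x).symm p.1 ∈ (chartAt (EuclideanSpace ℝ (Fin n)) x).source := by
    apply hbase.continuousAt.preimage_mem_nhds
    simpa using chart_source_mem_nhds (EuclideanSpace ℝ (Fin n)) x
  have hsec : ContMDiffAt 𝓘(ℝ, EuclideanSpace ℝ (Fin n) × EuclideanSpace ℝ (Fin n))
      ((𝓡 n).prod 𝓘(ℝ, EuclideanSpace ℝ (Fin n))) 1
      (fun p => (⟨(extChartAt (𝓡 n) x).symm p.1,
        (trivializationAt (EuclideanSpace ℝ (Fin n)) (TangentSpace (𝓡 n)) x).symmL ℝ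
          ((extChartAt (𝓡 n) x).symm p.1) p.2⟩ :
          TotalSpace (EuclideanSpace ℝ (Fin n)) (TangentSpace (𝓡 n) (M := M))))
      (extChartAt (𝓡 n) x x, u) := by
    rw [(trivializationAt (EuclideanSpace ℝ (Fin n)) (TangentSpace (𝓡 n)) x).contMDiffAt_iff]
    · refine ⟨hbase, ?_⟩
      have : ContMDiffAt 𝓘(ℝ, EuclideanSpace ℝ (Fin n) × EuclideanSpace ℝ (Fin n))
          𝓘(ℝ, EuclideanSpace ℝ (Fin n)) 1 Prod.snd (extChartAt (𝓡 n) x x, u) :=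
        contMDiffAt_iff_contDiffAt.2 contDiffAt_snd
      refine this.congr_of_eventuallyEq ?_
      filter_upwards [hsrc] with p hp
      rw [Trivialization.symmL_apply, Trivialization.apply_mk_symm]
      all_goals exact hp
    · rw [Trivialization.mem_source]
      simp
  have : IsContMDiffRiemannianBundle (𝓡 n) 1 (EuclideanSpace ℝ (Fin n))
      (fun x : M => TangentSpace (𝓡 n) x) := .of_le (n := ∞) (by simp)
  have := ContMDiffAt.inner_bundle (F := EuclideanSpace ℝ (Fin n))
    (E := fun x : M => TangentSpace (𝓡 n) x) hsec hsec
  simpa only [real_inner_self_eq_norm_sq] using this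

end Coordinates

section HolderAt

variable {X Y Z : Type*} [PseudoEMetricSpace X] [PseudoEMetricSpace Y] [PseudoEMetricSpace Z]

/-- `f` is Hölder with exponent `α` on a neighbourhood of `x`. -/
def HolderAt (α : ℝ≥0) (f : X → Y) (x : X) : Prop :=
  ∃ C : ℝ≥0, ∃ U ∈ 𝓝 x, HolderOnWith C α f U

lemma HolderAt.continuousAt {α : ℝ≥0} {f : X → Y} {x : X} (h : HolderAt α f x) (hα : 0 < α) :
    ContinuousAt f x := by
  obtain ⟨C, U, hU, hC⟩ := h
  exact (hC.continuousOn hα).continuousAt hU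

lemma HolderAt.congr {α : ℝ≥0} {f g : X → Y} {x : X} (h : HolderAt α f x) (hfg : g =ᶠ[𝓝 x] f) :
    HolderAt α g x := by
  obtain ⟨C, U, hU, hC⟩ := h
  refine ⟨C, U ∩ {z | g z = f z}, inter_mem hU hfg, fun z hz w hw => ?_⟩
  have h1 : g z = f z := hz.2
  have h2 : g w = f w := hw.2
  rw [h1, h2]
  exact hC z hz.1 w hw.1

lemma HolderAt.comp {α β : ℝ≥0} {g : Y → Z} {f : X → Y} {x : X} (hg : HolderAt α g (f x))
    (hf : HolderAt β f x) (hβ : 0 < β) : HolderAt (α * β) (g ∘ f) x := by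
  have hcont := hf.continuousAt hβ
  obtain ⟨C, U, hU, hC⟩ := hg
  obtain ⟨D, V, hV, hD⟩ := hf
  exact ⟨_, V ∩ f ⁻¹' U, inter_mem hV (hcont.preimage_mem_nhds hU),
    hC.comp (hD.mono inter_subset_left) fun z hz => hz.2⟩

lemma HolderAt.mono {α β : ℝ≥0} {f : X → Y} {x : X} (h : HolderAt β f x) (hαβ : α ≤ β) :
    HolderAt α f x := by
  obtain ⟨C, U, hU, hC⟩ := h
  refine ⟨C, U ∩ eball x (1 / 2), inter_mem hU (eball_mem_nhds _ (by simp)), fun z hz w hw => ?_⟩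
  refine (hC z hz.1 w hw.1).trans ?_
  gcongr C * ?_
  refine ENNReal.rpow_le_rpow_of_exponent_ge ?_ (by exact_mod_cast hαβ)
  calc edist z w ≤ edist z x + edist w x := edist_triangle_right _ _ _
    _ ≤ 1 / 2 + 1 / 2 := add_le_add (le_of_lt hz.2) (le_of_lt hw.2)
    _ = 1 := ENNReal.add_halves 1

lemma HolderAt.prodMk {α : ℝ≥0} {f : X → Y} {g : X → Z} {x : X} (hf : HolderAt α f x)
    (hg : HolderAt α g x) : HolderAt α (fun z => (f z, g z)) x := by
  obtain ⟨C, U, hU, hC⟩ := hf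
  obtain ⟨D, V, hV, hD⟩ := hg
  refine ⟨max C D, U ∩ V, inter_mem hU hV, fun z hz w hw => ?_⟩
  rw [Prod.edist_eq]
  refine max_le ((hC z hz.1 w hw.1).trans ?_) ((hD z hz.2 w hw.2).trans ?_)
  · gcongr; exact le_max_left _ _
  · gcongr; exact le_max_right _ _

lemma HolderAt.add {E : Type*} [SeminormedAddCommGroup E] {α : ℝ≥0} {f g : X → E} {x : X}
    (hf : HolderAt α f x) (hg : HolderAt α g x) : HolderAt α (fun z => f z + g z) x := by
  obtain ⟨C, U, hU, hC⟩ := hf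
  obtain ⟨D, V, hV, hD⟩ := hg
  refine ⟨C + D, U ∩ V, inter_mem hU hV, fun z hz w hw => ?_⟩
  calc edist (f z + g z) (f w + g w) ≤ edist (f z) (f w) + edist (g z) (g w) :=
        edist_add_add_le _ _ _ _
    _ ≤ C * edist z w ^ (α : ℝ) + D * edist z w ^ (α : ℝ) :=
        add_le_add (hC z hz.1 w hw.1) (hD z hz.2 w hw.2)
    _ = _ := by push_cast; ring

lemma _root_.ContDiffAt.holderAt {E F : Type*} [NormedAddCommGroup E] [NormedSpace ℝ E]
    [NormedAddCommGroup F] [NormedSpace ℝ F] {f : E → F} {x : E} (hf : ContDiffAt ℝ 1 f x) :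
    HolderAt 1 f x := by
  obtain ⟨K, U, hU, hK⟩ := hf.exists_lipschitzOnWith
  exact ⟨K, U, hU, hK.holderOnWith⟩

end HolderAt

section ConformalMaps

variable {n : ℕ} {M : Type*} [PseudoEMetricSpace M] [ChartedSpace (EuclideanSpace ℝ (Fin n)) M]
  [RiemannianBundle (fun x : M => TangentSpace (𝓡 n) x)]

variable (n) in
/-- A `C¹` local diffeomorphism which is conformal, with a conformal factor `a` whose logarithm
is locally `α`-Hölder. -/
structure IsHolderConformal (α : ℝ≥0) (f : M → M) (a : M → ℝ) : Prop where
  localDiffeo : IsLocalDiffeomorph (𝓡 n) (𝓡 n) 1 f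
  pos : ∀ x, 0 < a x
  norm_mfderiv : ∀ x (v : TangentSpace (𝓡 n) x), ‖mfderiv (𝓡 n) (𝓡 n) f x v‖ = a x * ‖v‖
  holder : ∀ x, HolderAt α (fun z => Real.log (a z)) x

lemma IsHolderConformal.continuous {α : ℝ≥0} {f : M → M} {a : M → ℝ} (hα : 0 < α)
    (h : IsHolderConformal n α f a) : Continuous a := by
  have : Continuous fun z => Real.log (a z) :=
    continuous_iff_continuousAt.2 fun x => (h.holder x).continuousAt hα
  exact (Real.continuous_exp.comp this).congr fun z => Real.exp_log (h.pos z)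

variable [IsManifold (𝓡 n) ∞ M] [IsContinuousRiemannianBundle (EuclideanSpace ℝ (Fin n))
    (fun x : M => TangentSpace (𝓡 n) x)] [IsRiemannianManifold (𝓡 n) M]

lemma _root_.IsLocalDiffeomorph.holderAt {f : M → M} (h : IsLocalDiffeomorph (𝓡 n) (𝓡 n) 1 f)
    (x : M) : HolderAt 1 f x := by
  obtain ⟨K, U, hU, hK⟩ := exists_lipschitzOnWith_of_contMDiffAt (h x).contMDiffAt
  exact ⟨K, U, hU, hK.holderOnWith⟩

lemma IsHolderConformal.comp {α : ℝ≥0} {f g : M → M} {a b : M → ℝ}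
    (hg : IsHolderConformal n α g b) (hf : IsHolderConformal n α f a) :
    IsHolderConformal n α (g ∘ f) fun x => b (f x) * a x where
  localDiffeo x := IsLocalDiffeomorphAt.comp (hf := hf.localDiffeo x) (hg := hg.localDiffeo (f x))
  pos x := mul_pos (hg.pos _) (hf.pos _)
  norm_mfderiv x v := by
    rw [mfderiv_comp x ((hg.localDiffeo _).mdifferentiableAt one_ne_zero)
      ((hf.localDiffeo _).mdifferentiableAt one_ne_zero)]
    refine (hg.norm_mfderiv (f x) (mfderiv (𝓡 n) (𝓡 n) f x v)).trans ?_
    rw [hf.norm_mfderiv, mul_assoc]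
  holder x := by
    have h1 := (hg.holder (f x)).comp (hf.localDiffeo.holderAt x) zero_lt_one
    rw [mul_one] at h1
    refine (h1.add (hf.holder x)).congr (Eventually.of_forall fun z => ?_)
    exact Real.log_mul (hg.pos _).ne' (hf.pos _).ne'

variable [IsContMDiffRiemannianBundle (𝓡 n) ∞ (EuclideanSpace ℝ (Fin n))
    (fun x : M => TangentSpace (𝓡 n) x)]

/-- A conformal `C^{1+α}` local diffeomorphism has a conformal factor with locally Hölder
logarithm. -/
lemma IsHolderLocalDiffeo.exists_isHolderConformal {α : ℝ≥0} (hα₀ : 0 < α) (hα₁ : α ≤ 1)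
    (hn : n ≠ 0) {f : M → M}
    (hf : IsHolderLocalDiffeo n α f) (hconf : IsConformal n f) :
    ∃ a, IsHolderConformal n α f a := by
  obtain ⟨a, ha⟩ := hconf
  obtain ⟨v₀, hv₀⟩ : ∃ v : EuclideanSpace ℝ (Fin n), v ≠ 0 :=
    ⟨EuclideanSpace.single ⟨0, Nat.pos_of_ne_zero hn⟩ 1, by simp⟩
  have hnorm : ∀ x (v : TangentSpace (𝓡 n) x), ‖mfderiv (𝓡 n) (𝓡 n) f x v‖ = |a x| * ‖v‖ := by
    intro x v
    obtain ⟨L, hL⟩ := ha x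
    rw [hL v, norm_smul, Real.norm_eq_abs, L.norm_map]
  have hinj : ∀ x (v : TangentSpace (𝓡 n) x), v ≠ 0 → mfderiv (𝓡 n) (𝓡 n) f x v ≠ 0 := by
    intro x v hv h0
    apply hv
    exact (((hf.1 x).mfderivToContinuousLinearEquiv one_ne_zero).map_eq_zero_iff (x := v)).1 h0
  have hpos : ∀ x, 0 < |a x| := by
    intro x
    rcases (abs_nonneg (a x)).eq_or_lt with h | h
    · have h1 := hnorm x v₀
      rw [← h, zero_mul, norm_eq_zero] at h1
      exact absurd h1 (hinj x v₀ hv₀)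
    · exact h
  refine ⟨fun x => |a x|, hf.1, hpos, hnorm, fun x => ?_⟩
  let e : ∀ x : M, _ := fun x =>
    trivializationAt (EuclideanSpace ℝ (Fin n)) (TangentSpace (𝓡 n) (M := M)) x
  let N : M → EuclideanSpace ℝ (Fin n) × EuclideanSpace ℝ (Fin n) → ℝ := fun x p =>
    ‖(e x).symmL ℝ ((extChartAt (𝓡 n) x).symm p.1) p.2‖ ^ 2
  have hN : ∀ x u, ContDiffAt ℝ 1 (N x) (extChartAt (𝓡 n) x x, u) := contDiffAt_sq_norm_symmL
  have hNz : ∀ x z u, z ∈ (chartAt (EuclideanSpace ℝ (Fin n)) x).source →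
      N x (extChartAt (𝓡 n) x z, u) = ‖(e x).symmL ℝ z u‖ ^ 2 := by
    intro x z u hz
    have : (extChartAt (𝓡 n) x).symm (extChartAt (𝓡 n) x z) = z :=
      (extChartAt (𝓡 n) x).left_inv (by simpa using hz)
    simp only [N]
    rw [this]
  have hsymm : ∀ x z, z ∈ (chartAt (EuclideanSpace ℝ (Fin n)) x).source →
      (e x).symmL ℝ z v₀ ≠ 0 := by
    intro x z hz h0
    have h1 := (e x).continuousLinearMapAt_symmL (R := ℝ) (b := z) hz v₀
    rw [h0, map_zero] at h1
    exact hv₀ h1.symm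
  let fh := writtenInExtChartAt (𝓡 n) (𝓡 n) x f
  let P : EuclideanSpace ℝ (Fin n) → EuclideanSpace ℝ (Fin n) × EuclideanSpace ℝ (Fin n) :=
    fun y => (fh y, fderiv ℝ fh y v₀)
  have hfh : ∀ z ∈ (chartAt (EuclideanSpace ℝ (Fin n)) x).source,
      fh (extChartAt (𝓡 n) x z) = extChartAt (𝓡 n) (f x) (f z) := by
    intro z hz
    have : (extChartAt (𝓡 n) x).symm (extChartAt (𝓡 n) x z) = z :=
      (extChartAt (𝓡 n) x).left_inv (by simpa using hz)
    simp only [fh, writtenInExtChartAt, Function.comp_apply, this]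
  have hNP : ∀ z ∈ (chartAt (EuclideanSpace ℝ (Fin n)) x).source,
      f z ∈ (chartAt (EuclideanSpace ℝ (Fin n)) (f x)).source →
      N (f x) (P (extChartAt (𝓡 n) x z)) = |a z| ^ 2 * ‖(e x).symmL ℝ z v₀‖ ^ 2 := by
    intro z hz hfz
    simp only [P]
    rw [hfh z hz, hNz (f x) (f z) _ hfz, ← mul_pow, ← hnorm]
    congr 2
    exact symmL_fderiv_writtenInExtChartAt hz hfz ((hf.1 z).mdifferentiableAt one_ne_zero) v₀
  have hxs := mem_chart_source (EuclideanSpace ℝ (Fin n)) x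
  have hfxs := mem_chart_source (EuclideanSpace ℝ (Fin n)) (f x)
  have hsq : ∀ z ∈ (chartAt (EuclideanSpace ℝ (Fin n)) x).source,
      0 < ‖(e x).symmL ℝ z v₀‖ ^ 2 := fun z hz => by
    have := norm_pos_iff.2 (hsymm x z hz)
    positivity
  have hfhC : ContDiffAt ℝ 1 fh (extChartAt (𝓡 n) x x) := by
    have := (contMDiffAt_iff.1 (hf.1 x).contMDiffAt).2
    rwa [ModelWithCorners.range_eq_univ, contDiffWithinAt_univ] at this
  have hP : HolderAt α P (extChartAt (𝓡 n) x x) := by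
    refine HolderAt.prodMk (hfhC.holderAt.mono hα₁) ?_
    have h1 : HolderAt 1 (fun T : EuclideanSpace ℝ (Fin n) →L[ℝ] EuclideanSpace ℝ (Fin n) => T v₀)
        (fderiv ℝ fh (extChartAt (𝓡 n) x x)) :=
      (ContinuousLinearMap.apply ℝ (EuclideanSpace ℝ (Fin n)) v₀).contDiff.contDiffAt.holderAt
    have h2 := h1.comp (f := fderiv ℝ fh) (hf.2 x) hα₀
    rwa [one_mul] at h2
  have hQ₁ : HolderAt α (fun y => Real.log (N (f x) (P y))) (extChartAt (𝓡 n) x x) := by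
    have h1 : ContDiffAt ℝ 1 (fun p => Real.log (N (f x) p)) (P (extChartAt (𝓡 n) x x)) := by
      refine ContDiffAt.log ?_ ?_
      · simp only [P]
        rw [hfh x hxs]
        exact hN _ _
      · rw [hNP x hxs hfxs]
        exact (mul_pos (pow_pos (hpos x) 2) (hsq x hxs)).ne'
    have h2 := h1.holderAt.comp hP hα₀
    rwa [one_mul] at h2
  have hQ₂ : HolderAt α (fun y => Real.log (N x (y, v₀))) (extChartAt (𝓡 n) x x) := by
    refine HolderAt.mono (ContDiffAt.holderAt ?_) hα₁
    refine ContDiffAt.log ?_ ?_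
    · exact ContDiffAt.comp (f := fun y => (y, v₀)) _ (hN x v₀)
        (contDiffAt_id.prodMk contDiffAt_const)
    · rw [hNz x x _ hxs]
      exact (hsq x hxs).ne'
  have hQ : HolderAt α (fun y => 2⁻¹ * (Real.log (N (f x) (P y)) + -Real.log (N x (y, v₀))))
      (extChartAt (𝓡 n) x x) := by
    have hneg : HolderAt 1 (fun t : ℝ => -t) (Real.log (N x (extChartAt (𝓡 n) x x, v₀))) :=
      contDiff_neg.contDiffAt.holderAt
    have h1 := hneg.comp (f := fun y => Real.log (N x (y, v₀))) hQ₂ hα₀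
    rw [one_mul] at h1
    have hmul : ∀ s, HolderAt 1 (fun t : ℝ => 2⁻¹ * t) s := fun s =>
      (contDiff_const.mul contDiff_id).contDiffAt.holderAt
    have h2 := (hmul _).comp (hQ₁.add h1) hα₀
    rwa [one_mul] at h2
  obtain ⟨K, U, hU, hK⟩ := exists_lipschitzOnWith_extChartAt n x
  have hQφ := hQ.comp (f := extChartAt (𝓡 n) x) ⟨K, U, hU, hK.holderOnWith⟩ zero_lt_one
  rw [mul_one] at hQφ
  refine hQφ.congr ?_
  filter_upwards [chart_source_mem_nhds (EuclideanSpace ℝ (Fin n)) x,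
    (hf.1 x).contMDiffAt.continuousAt.preimage_mem_nhds
      (chart_source_mem_nhds (EuclideanSpace ℝ (Fin n)) (f x))] with z hz hfz
  simp only [Function.comp_apply]
  rw [hNP z hz hfz, hNz x z v₀ hz, Real.log_mul (pow_pos (hpos z) 2).ne' (hsq z hz).ne',
    Real.log_pow]
  push_cast
  ring

end ConformalMaps

section InverseBranches

/-- The factor `exp (C r^α)` which bounds the distortion at scale `r`. -/
noncomputable def distortion (α C r : ℝ≥0) : ℝ≥0 := (Real.exp (C * (r : ℝ) ^ (α : ℝ))).toNNReal

lemma coe_distortion (α C r : ℝ≥0) : (distortion α C r : ℝ) = Real.exp (C * (r : ℝ) ^ (α : ℝ)) :=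
  Real.coe_toNNReal _ (Real.exp_pos _).le

lemma distortion_mono {α C C' r r' : ℝ≥0} (hC : C ≤ C') (hr : r ≤ r') :
    distortion α C r ≤ distortion α C' r' := by
  rw [← NNReal.coe_le_coe, coe_distortion, coe_distortion, Real.exp_le_exp]
  have : (C : ℝ) ≤ C' := hC
  have : (r : ℝ) ≤ r' := hr
  gcongr

lemma distortion_mul {α C C' l r : ℝ≥0} (h : C + C' * l ^ (α : ℝ) = C') :
    distortion α C r * distortion α C' (l * r) = distortion α C' r := by
  rw [← NNReal.coe_inj, NNReal.coe_mul, coe_distortion, coe_distortion, coe_distortion,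
    ← Real.exp_add]
  congr 1
  have h' : (C : ℝ) + C' * (l : ℝ) ^ (α : ℝ) = C' := by exact_mod_cast h
  rw [NNReal.coe_mul, Real.mul_rpow l.coe_nonneg r.coe_nonneg]
  linear_combination ((r : ℝ) ^ (α : ℝ)) * h'

lemma distortion_mul_const (α C c r : ℝ≥0) :
    distortion α C (c * r) = distortion α (C * c ^ (α : ℝ)) r := by
  rw [← NNReal.coe_inj, coe_distortion, coe_distortion, NNReal.coe_mul,
    Real.mul_rpow c.coe_nonneg r.coe_nonneg]
  push_cast
  rw [mul_assoc]

variable {X : Type*} [PseudoEMetricSpace X]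

/-- `g` is an inverse branch of `f` on the ball of radius `δ` around `f x`, and `f` is close to a
similarity of ratio `Λ` at all scales smaller than `δ`. -/
structure IsInverseBranch (α C δ Λ : ℝ≥0) (f g : X → X) (x : X) : Prop where
  left_inv : g (f x) = x
  right_inv : ∀ z ∈ eball (f x) δ, f (g z) = z
  edist_le : ∀ r ≤ δ, ∀ z ∈ eball (f x) r,
    edist (g z) x ≤ (Λ⁻¹ * distortion α C r : ℝ≥0) * edist z (f x)
  lipschitzOnWith : ∀ r ≤ δ, LipschitzOnWith (Λ * distortion α C r) f (g '' eball (f x) r)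

lemma IsInverseBranch.mono {α C C' δ δ' Λ : ℝ≥0} {f g : X → X} {x : X}
    (h : IsInverseBranch α C δ Λ f g x) (hC : C ≤ C') (hδ : δ' ≤ δ) :
    IsInverseBranch α C' δ' Λ f g x where
  left_inv := h.left_inv
  right_inv z hz := h.right_inv z (eball_subset_eball (by exact_mod_cast hδ) hz)
  edist_le r hr z hz := (h.edist_le r (hr.trans hδ) z hz).trans (by
    gcongr; exact distortion_mono hC le_rfl)
  lipschitzOnWith r hr := (h.lipschitzOnWith r (hr.trans hδ)).weaken (by
    gcongr; exact distortion_mono hC le_rfl)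

/-- Composition of an inverse branch with a contracting one. -/
lemma IsInverseBranch.comp {α C C' δ Λ Λ' l : ℝ≥0} {f g F G : X → X} {x : X}
    (hF : IsInverseBranch α C' δ Λ' F G x) (hf : IsInverseBranch α C δ Λ f g (F x))
    (hl : l ≤ 1) (hg : ∀ z ∈ eball (f (F x)) δ, edist (g z) (F x) ≤ l * edist z (f (F x)))
    (hl₀ : l ≠ 0) (hC : C + C' * l ^ (α : ℝ) = C') :
    IsInverseBranch α C' δ (Λ * Λ') (f ∘ F) (G ∘ g) x := by
  have hlr : ∀ r : ℝ≥0, r ≤ δ → l * r ≤ δ := fun r hr =>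
    (mul_le_of_le_one_left (zero_le) hl).trans hr
  have hmaps : ∀ r : ℝ≥0, r ≤ δ → ∀ z ∈ eball (f (F x)) r, g z ∈ eball (F x) (l * r : ℝ≥0) := by
    intro r hr z hz
    have hz' : z ∈ eball (f (F x)) δ := eball_subset_eball (by exact_mod_cast hr) hz
    rw [mem_eball] at hz ⊢
    refine (hg z hz').trans_lt ?_
    rw [ENNReal.coe_mul]
    exact ENNReal.mul_lt_mul_right (by simpa using hl₀) ENNReal.coe_ne_top hz
  refine ⟨?_, ?_, ?_, ?_⟩
  · simp [hf.left_inv, hF.left_inv]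
  · intro z hz
    have h1 := hmaps δ le_rfl z hz
    have h2 : g z ∈ eball (F x) δ := eball_subset_eball (by exact_mod_cast hlr δ le_rfl) h1
    simp [hF.right_inv _ h2, hf.right_inv z hz]
  · intro r hr z hz
    refine (hF.edist_le _ (hlr r hr) (g z) (hmaps r hr z hz)).trans ?_
    refine (mul_le_mul_right (hf.edist_le r hr z hz) _).trans_eq ?_
    rw [← mul_assoc, ← ENNReal.coe_mul]
    congr 2
    rw [← distortion_mul hC (r := r), mul_inv]
    ring
  · intro r hr
    have h1 : LipschitzOnWith (Λ' * distortion α C' (l * r)) F ((G ∘ g) '' eball (f (F x)) r) := by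
      refine (hF.lipschitzOnWith _ (hlr r hr)).mono ?_
      rintro _ ⟨z, hz, rfl⟩
      exact ⟨g z, hmaps r hr z hz, rfl⟩
    have h2 := (hf.lipschitzOnWith r hr).comp h1 (by
      rintro _ ⟨z, hz, rfl⟩
      have h2 : g z ∈ eball (F x) δ :=
        eball_subset_eball (by exact_mod_cast hlr r hr) (hmaps r hr z hz)
      exact ⟨z, hz, (hF.right_inv _ h2).symm⟩)
    refine h2.weaken (le_of_eq ?_)
    rw [← distortion_mul hC (r := r)]
    ring

/-- If every point has a uniformly contracting inverse branch of an element of a semigroup, then it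
has inverse branches with arbitrarily large ratio and uniformly bounded distortion. -/
lemma exists_isInverseBranch_iterate {α C δ l : ℝ≥0} (hα : 0 < α) (hl₀ : l ≠ 0) (hl : l < 1)
    {Γ : Subsemigroup (Function.End X)}
    (hΓ : ∀ x : X, ∃ f ∈ Γ, ∃ g : X → X, ∃ Λ : ℝ≥0, IsInverseBranch α C δ Λ f g x ∧
      (∀ z ∈ eball (f x) δ, edist (g z) x ≤ l * edist z (f x)) ∧ 1 ≤ l * Λ) :
    ∃ C' : ℝ≥0, ∀ k : ℕ, ∀ x : X, ∃ f ∈ Γ, ∃ g : X → X, ∃ Λ : ℝ≥0,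
      IsInverseBranch α C' δ Λ f g x ∧ 1 ≤ l ^ k * Λ := by
  have hlα : l ^ (α : ℝ) < 1 := NNReal.rpow_lt_one hl (by exact_mod_cast hα)
  have hC : C + C / (1 - l ^ (α : ℝ)) * l ^ (α : ℝ) = C / (1 - l ^ (α : ℝ)) := by
    have h1 : (1 - l ^ (α : ℝ)) ≠ 0 := (tsub_pos_of_lt hlα).ne'
    have h2 : (1 - l ^ (α : ℝ)) + l ^ (α : ℝ) = 1 := tsub_add_cancel_of_le hlα.le
    field_simp
    rw [h2, mul_one]
  have hCC : C ≤ C / (1 - l ^ (α : ℝ)) := by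
    conv_rhs => rw [← hC]
    exact le_self_add
  refine ⟨C / (1 - l ^ (α : ℝ)), fun k x => ?_⟩
  induction k with
  | zero =>
    obtain ⟨f, hf, g, Λ, h, -, hΛ⟩ := hΓ x
    refine ⟨f, hf, g, Λ, h.mono hCC le_rfl, ?_⟩
    rw [pow_zero, one_mul]
    exact hΛ.trans (mul_le_of_le_one_left (zero_le) hl.le)
  | succ k ih =>
    obtain ⟨F, hF, G, Λ', h', hΛ'⟩ := ih
    obtain ⟨f, hf, g, Λ, h, hg, hΛ⟩ := hΓ (F x)
    refine ⟨f * F, mul_mem hf hF, G ∘ g, Λ * Λ', h'.comp h hl.le hg hl₀ hC, ?_⟩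
    calc (1 : ℝ≥0) ≤ (l ^ k * Λ') * (l * Λ) := one_le_mul hΛ' hΛ
      _ = _ := by ring

end InverseBranches

section UniformBranches

variable {n : ℕ} {M : Type*} [PseudoEMetricSpace M] [ChartedSpace (EuclideanSpace ℝ (Fin n)) M]
  [RiemannianBundle (fun x : M => TangentSpace (𝓡 n) x)] [IsRiemannianManifold (𝓡 n) M]

/-- Around a point where it is expanding, a conformal map has uniformly contracting inverse
branches. -/
lemma IsHolderConformal.exists_isInverseBranch {α : ℝ≥0} (hα : 0 < α) {f : M → M} {a : M → ℝ}
    (hf : IsHolderConformal n α f a) {x₀ : M} (hx₀ : 1 < a x₀) :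
    ∃ δ C l : ℝ≥0, 0 < δ ∧ l < 1 ∧ ∀ᶠ x in 𝓝 x₀, ∃ g : M → M, ∃ Λ : ℝ≥0,
      IsInverseBranch α C δ Λ f g x ∧
      (∀ z ∈ eball (f x) δ, edist (g z) x ≤ l * edist z (f x)) ∧ 1 ≤ l * Λ := by
  obtain ⟨σ, hσ₁, hσ⟩ := exists_between hx₀
  have hσ₀ : 0 < σ := one_pos.trans hσ₁
  obtain ⟨C, U, hU, hC⟩ := hf.holder x₀
  let g := (hf.localDiffeo x₀).localInverse
  have hgs : g.source ∈ 𝓝 (f x₀) :=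
    g.open_source.mem_nhds (hf.localDiffeo x₀).localInverse_mem_source
  have hgt : g.target ∈ 𝓝 x₀ := g.open_target.mem_nhds (hf.localDiffeo x₀).localInverse_mem_target
  have hW : U ∩ {x | σ < a x} ∩ g.target ∈ 𝓝 x₀ :=
    inter_mem (inter_mem hU ((hf.continuous hα).continuousAt.eventually_const_lt hσ)) hgt
  have hgx₀ : g (f x₀) = x₀ :=
    (hf.localDiffeo x₀).localInverse_left_inv (hf.localDiffeo x₀).localInverse_mem_target
  have hgc : ContinuousAt g (f x₀) := (hf.localDiffeo x₀).localInverse_contMDiffAt.continuousAt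
  have hV : g.source ∩ g ⁻¹' (U ∩ {x | σ < a x} ∩ g.target) ∈ 𝓝 (f x₀) :=
    inter_mem hgs (hgc.preimage_mem_nhds (by rwa [hgx₀]))
  generalize hWd : U ∩ {x | σ < a x} ∩ g.target = W at hW hV
  obtain ⟨ε₁, hε₁, hε₁W⟩ := EMetric.mem_nhds_iff.1 hW
  obtain ⟨ε₂, hε₂, hε₂V⟩ := EMetric.mem_nhds_iff.1 hV
  obtain ⟨δ, hδ₀, hδ⟩ : ∃ δ : ℝ≥0, 0 < δ ∧ (δ : ℝ≥0∞) < min ε₁ ε₂ / 4 := by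
    have : (0 : ℝ≥0∞) < min ε₁ ε₂ / 4 := ENNReal.div_pos (lt_min hε₁ hε₂).ne' (by simp)
    obtain ⟨δ, h1, h2⟩ := ENNReal.lt_iff_exists_nnreal_btwn.1 this
    exact ⟨δ, by exact_mod_cast h1, h2⟩
  have h4δ : 4 * (δ : ℝ≥0∞) ≤ min ε₁ ε₂ := by
    rw [mul_comm]
    exact ENNReal.mul_le_of_le_div hδ.le
  have hWδ : eball x₀ (4 * δ) ⊆ W := (eball_subset_eball (h4δ.trans (min_le_left _ _))).trans hε₁W
  have hVδ : eball (f x₀) (4 * δ) ⊆ g.source ∩ g ⁻¹' W :=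
    (eball_subset_eball (h4δ.trans (min_le_right _ _))).trans hε₂V
  have hsub : ∀ {p q : M} {s : ℝ≥0∞}, p ∈ eball q δ → s ≤ 3 * δ → eball p s ⊆ eball q (4 * δ) := by
    intro p q s hp hs w hw
    rw [mem_eball] at *
    calc edist w q ≤ edist w p + edist p q := edist_triangle _ _ _
      _ < s + δ := ENNReal.add_lt_add hw hp
      _ ≤ 3 * δ + δ := by gcongr
      _ = 4 * δ := by ring
  have hWU : W ⊆ U := by rw [← hWd]; exact fun z hz => hz.1.1
  have hWσ : ∀ z ∈ W, σ < a z := by rw [← hWd]; exact fun z hz => hz.1.2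
  have hWt : W ⊆ g.target := by rw [← hWd]; exact fun z hz => hz.2
  -- the conformal factors at two points of `W` at distance at most `s`
  have hdist : ∀ z ∈ W, ∀ w ∈ W, ∀ s : ℝ≥0, edist z w ≤ s →
      a z ≤ a w * distortion α C s := by
    intro z hz w hw s hs
    have h1 := hC.edist_le_of_le (hWU hz) (hWU hw) hs
    rw [← ENNReal.coe_rpow_of_nonneg _ α.coe_nonneg, ← ENNReal.coe_mul, edist_nndist,
      ENNReal.coe_le_coe, ← NNReal.coe_le_coe, coe_nndist, Real.dist_eq] at h1
    push_cast at h1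
    rw [coe_distortion, ← Real.log_le_log_iff (hf.pos z) (mul_pos (hf.pos w) (Real.exp_pos _)),
      Real.log_mul (hf.pos w).ne' (Real.exp_pos _).ne', Real.log_exp]
    linarith [le_abs_self (Real.log (a z) - Real.log (a w))]
  have hnorm_congr : ∀ {p q : M} (_ : p = q) (v : EuclideanSpace ℝ (Fin n)),
      @norm (TangentSpace (𝓡 n) p) _ v = @norm (TangentSpace (𝓡 n) q) _ v := by
    rintro p _ rfl v
    rfl
  have hgd : ∀ z ∈ g.source, ∀ v : TangentSpace (𝓡 n) z,
      ‖mfderiv (𝓡 n) (𝓡 n) g z v‖ = (a (g z))⁻¹ * ‖v‖ := by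
    intro z hz v
    have h1 : f ∘ g =ᶠ[𝓝 z] id := Filter.eventuallyEq_of_mem (g.open_source.mem_nhds hz)
      (hf.localDiffeo x₀).localInverse_eqOn_right
    have h2 := h1.mfderiv_eq (I := 𝓡 n) (I' := 𝓡 n)
    rw [mfderiv_comp z ((hf.localDiffeo _).mdifferentiableAt one_ne_zero)
      (g.mdifferentiableAt one_ne_zero hz), mfderiv_id] at h2
    have h3 : mfderiv (𝓡 n) (𝓡 n) f (g z) (mfderiv (𝓡 n) (𝓡 n) g z v) = v := congr($h2 v)
    have h4 := hf.norm_mfderiv (g z) (mfderiv (𝓡 n) (𝓡 n) g z v)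
    rw [h3, hnorm_congr ((hf.localDiffeo x₀).localInverse_right_inv hz) v] at h4
    rw [eq_inv_mul_iff_mul_eq₀ (hf.pos _).ne', ← h4]
  refine ⟨δ, C * 3 ^ (α : ℝ), σ⁻¹.toNNReal, hδ₀, ?_, ?_⟩
  · rw [Real.toNNReal_lt_one]
    exact inv_lt_one_of_one_lt₀ hσ₁
  filter_upwards [eball_mem_nhds x₀ (ENNReal.coe_pos.2 hδ₀),
    (hf.localDiffeo x₀).contMDiffAt.continuousAt.preimage_mem_nhds
      (eball_mem_nhds (f x₀) (ENNReal.coe_pos.2 hδ₀))] with x hx hfx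
  have hl₁ : σ⁻¹.toNNReal ≤ 1 := by
    rw [Real.toNNReal_le_one]
    exact inv_le_one_of_one_le₀ hσ₁.le
  have hcoe : ((a x).toNNReal : ℝ) = a x := Real.coe_toNNReal _ (hf.pos x).le
  have hxW : x ∈ W := hWδ (hsub hx le_rfl (mem_eball_self (by simpa using hδ₀)))
  have hgfx : g (f x) = x := (hf.localDiffeo x₀).localInverse_left_inv (hWt hxW)
  have hball : ∀ r : ℝ≥0, r ≤ δ → eball (f x) r ⊆ g.source ∩ g ⁻¹' W := fun r hr =>
    (hsub hfx (calc (r : ℝ≥0∞) ≤ δ := by exact_mod_cast hr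
      _ = 1 * δ := (one_mul _).symm
      _ ≤ 3 * δ := by gcongr; norm_num)).trans hVδ
  have hgsm : ∀ r : ℝ≥0, r ≤ δ → ContMDiffOn (𝓡 n) (𝓡 n) 1 g (eball (f x) r) := fun r hr =>
    (hf.localDiffeo x₀).localInverse_contMDiffOn.mono fun z hz => (hball r hr hz).1
  have hcontr : ∀ z ∈ eball (f x) δ, edist (g z) x ≤ σ⁻¹.toNNReal * edist z (f x) := by
    intro z hz
    have := edist_le_of_enorm_mfderiv_le (K := σ⁻¹.toNNReal) (hgsm δ le_rfl) (fun w hw v => by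
      apply enorm_le_coe_mul_enorm
      have hw' := hball δ le_rfl hw
      rw [hgd w hw'.1 v, Real.coe_toNNReal _ (inv_pos.2 hσ₀).le]
      gcongr
      exact (hWσ _ hw'.2).le) hz
    rwa [hgfx, edist_comm x, edist_comm (f x)] at this
  have hle : ∀ r : ℝ≥0, r ≤ δ → ∀ z ∈ eball (f x) r, edist (g z) x ≤ edist z (f x) := by
    intro r hr z hz
    refine (hcontr z (eball_subset_eball (by exact_mod_cast hr) hz)).trans ?_
    exact mul_le_of_le_one_left (zero_le) (by exact_mod_cast hl₁)
  refine ⟨g, (a x).toNNReal, ⟨hgfx, ?_, ?_, ?_⟩, hcontr, ?_⟩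
  · exact fun z hz => (hf.localDiffeo x₀).localInverse_right_inv (hball δ le_rfl hz).1
  · intro r hr z hz
    have := edist_le_of_enorm_mfderiv_le (K := (a x).toNNReal⁻¹ * distortion α C r) (hgsm r hr)
      (fun w hw v => by
        apply enorm_le_coe_mul_enorm
        have hw' := hball r hr hw
        rw [hgd w hw'.1 v, NNReal.coe_mul, NNReal.coe_inv, hcoe]
        gcongr
        have h1 := hdist x hxW (g w) hw'.2 r
          (by rw [edist_comm]; exact (hle r hr w hw).trans (le_of_lt hw))
        rw [inv_le_iff_one_le_mul₀ (hf.pos _), mul_assoc, ← div_eq_inv_mul, one_le_div (hf.pos _),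
          mul_comm]
        exact h1) hz
    rw [hgfx, edist_comm x, edist_comm (f x)] at this
    refine this.trans ?_
    gcongr
    refine distortion_mono ?_ le_rfl
    exact le_mul_of_one_le_right (zero_le) (NNReal.one_le_rpow (by norm_num) α.coe_nonneg)
  · intro r hr
    have h1 : g '' eball (f x) r ⊆ eball x r := by
      rintro _ ⟨z, hz, rfl⟩
      exact (hle r hr z hz).trans_lt hz
    refine LipschitzOnWith.mono ?_ h1
    refine lipschitzOnWith_of_enorm_mfderiv_le (I := 𝓡 n) (J := 𝓡 n) (R := 3 * r)
      hf.localDiffeo.contMDiff.contMDiffOn (fun w hw v => ?_) le_rfl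
    apply enorm_le_coe_mul_enorm
    rw [hf.norm_mfderiv, NNReal.coe_mul, hcoe, ← distortion_mul_const]
    gcongr
    have hwW : w ∈ W := hWδ (hsub hx (by gcongr) hw)
    refine hdist w hwW x hxW (3 * r) ?_
    rw [ENNReal.coe_mul]
    exact le_of_lt hw
  · rw [← NNReal.coe_le_coe, NNReal.coe_mul, hcoe, Real.coe_toNNReal _ (inv_pos.2 hσ₀).le,
      NNReal.coe_one, ← div_eq_inv_mul, one_le_div hσ₀]
    exact (hWσ x hxW).le

/-- On a compact manifold, a backward expanding semigroup of conformal maps has uniformly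
contracting inverse branches. -/
lemma exists_uniform_isInverseBranch [CompactSpace M] {α : ℝ≥0} (hα : 0 < α)
    {Γ : Subsemigroup (Function.End M)}
    (hΓ : ∀ x : M, ∃ f ∈ Γ, ∃ a : M → ℝ, IsHolderConformal n α f a ∧ 1 < a x) :
    ∃ δ C l : ℝ≥0, 0 < δ ∧ l ≠ 0 ∧ l < 1 ∧ ∀ x : M, ∃ f ∈ Γ, ∃ g : M → M, ∃ Λ : ℝ≥0,
      IsInverseBranch α C δ Λ f g x ∧
      (∀ z ∈ eball (f x) δ, edist (g z) x ≤ l * edist z (f x)) ∧ 1 ≤ l * Λ := by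
  have key : ∃ δ C l : ℝ≥0, 0 < δ ∧ l ≠ 0 ∧ l < 1 ∧ ∀ x ∈ (univ : Set M), ∃ f ∈ Γ,
      ∃ g : M → M, ∃ Λ : ℝ≥0, IsInverseBranch α C δ Λ f g x ∧
      (∀ z ∈ eball (f x) δ, edist (g z) x ≤ l * edist z (f x)) ∧ 1 ≤ l * Λ := by
    refine isCompact_univ.induction_on ?_ ?_ ?_ ?_
    · exact ⟨1, 0, 1 / 2, one_pos, by simp, by simpa using NNReal.half_lt_self one_ne_zero, by simp⟩
    · rintro s t hst ⟨δ, C, l, hδ, hl₀, hl, h⟩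
      exact ⟨δ, C, l, hδ, hl₀, hl, fun x hx => h x (hst hx)⟩
    · rintro s t ⟨δ, C, l, hδ, hl₀, hl, h⟩ ⟨δ', C', l', hδ', hl₀', hl', h'⟩
      refine ⟨min δ δ', max C C', max l l', lt_min hδ hδ', ?_, max_lt hl hl', ?_⟩
      · exact (lt_of_lt_of_le (pos_iff_ne_zero.2 hl₀) (le_max_left _ _)).ne'
      · rintro x (hx | hx)
        · obtain ⟨f, hf, g, Λ, hb, hc, hΛ⟩ := h x hx
          refine ⟨f, hf, g, Λ, hb.mono (le_max_left _ _) (min_le_left _ _), fun z hz => ?_,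
            hΛ.trans (by gcongr; exact le_max_left _ _)⟩
          refine (hc z (eball_subset_eball (by exact_mod_cast min_le_left _ _) hz)).trans ?_
          gcongr
          exact le_max_left _ _
        · obtain ⟨f, hf, g, Λ, hb, hc, hΛ⟩ := h' x hx
          refine ⟨f, hf, g, Λ, hb.mono (le_max_right _ _) (min_le_right _ _), fun z hz => ?_,
            hΛ.trans (by gcongr; exact le_max_right _ _)⟩
          refine (hc z (eball_subset_eball (by exact_mod_cast min_le_right _ _) hz)).trans ?_
          gcongr
          exact le_max_right _ _
    · intro x _
      obtain ⟨f, hf, a, ha, hax⟩ := hΓ x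
      obtain ⟨δ, C, l, hδ, hl, h⟩ := ha.exists_isInverseBranch hα hax
      have hl₀ : l ≠ 0 := by
        rintro rfl
        obtain ⟨g, Λ, -, -, hΛ⟩ := h.self_of_nhds
        simp at hΛ
      refine ⟨_, mem_nhdsWithin_of_mem_nhds h, δ, C, l, hδ, hl₀, hl, fun y hy => ⟨f, hf, hy⟩⟩
  simpa using key

end UniformBranches

section HausdorffMeasure

lemma isAddHaarMeasure_hausdorffMeasure_euclideanSpace (n : ℕ) :
    (μH[(n : ℝ)] : Measure (EuclideanSpace ℝ (Fin n))).IsAddHaarMeasure := by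
  have := (inferInstance : (μH[(Module.finrank ℝ (EuclideanSpace ℝ (Fin n)) : ℝ)] :
    Measure (EuclideanSpace ℝ (Fin n))).IsAddHaarMeasure)
  rwa [finrank_euclideanSpace_fin] at this

lemma volume_absolutelyContinuous_hausdorffMeasure (n : ℕ) :
    (volume : Measure (EuclideanSpace ℝ (Fin n))) ≪ μH[(n : ℝ)] := by
  have := isAddHaarMeasure_hausdorffMeasure_euclideanSpace n
  rw [Measure.isAddLeftInvariant_eq_smul (volume : Measure (EuclideanSpace ℝ (Fin n))) μH[(n : ℝ)]]
  exact Measure.smul_absolutelyContinuous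

lemma hausdorffMeasure_image_le_pow {X Y : Type*} [EMetricSpace X] [EMetricSpace Y]
    [MeasurableSpace X] [BorelSpace X] [MeasurableSpace Y] [BorelSpace Y] {K : ℝ≥0} {f : X → Y}
    {s t : Set X} (h : LipschitzOnWith K f t) (hst : s ⊆ t) (n : ℕ) :
    μH[(n : ℝ)] (f '' s) ≤ (K : ℝ≥0∞) ^ n * μH[(n : ℝ)] s := by
  simpa only [ENNReal.rpow_natCast] using (h.mono hst).hausdorffMeasure_image_le n.cast_nonneg

lemma _root_.MeasureTheory.Measure.AbsolutelyContinuous.le_top_smul {X : Type*} [MeasurableSpace X]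
    {μ ν : Measure X} (h : μ ≪ ν) : μ ≤ (⊤ : ℝ≥0∞) • ν := by
  refine Measure.le_iff.2 fun s _ => ?_
  rw [Measure.smul_apply, smul_eq_mul]
  by_cases hs : ν s = 0
  · simp [h hs]
  · simp [ENNReal.top_mul hs]

variable {n : ℕ} {M : Type*} [EMetricSpace M] [ChartedSpace (EuclideanSpace ℝ (Fin n)) M]
  [IsManifold (𝓡 n) ∞ M] [RiemannianBundle (fun x : M => TangentSpace (𝓡 n) x)]
  [IsContinuousRiemannianBundle (EuclideanSpace ℝ (Fin n)) (fun x : M => TangentSpace (𝓡 n) x)]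
  [IsRiemannianManifold (𝓡 n) M] [MeasurableSpace M] [BorelSpace M]

lemma chartVolume_absolutelyContinuous (x : M) :
    chartVolume (n := n) x ≪ μH[(n : ℝ)] := by
  refine Measure.AbsolutelyContinuous.mk fun s hs h0 => ?_
  rw [chartVolume]
  by_cases hm : AEMeasurable (extChartAt (𝓡 n) x).symm
    (((volume : Measure (EuclideanSpace ℝ (Fin n))).restrict
      (extChartAt (𝓡 n) x).target).withDensity fun y => ENNReal.ofReal √(metricMatrix x y).det)
  swap
  · rw [Measure.map_of_not_aemeasurable hm]; rfl
  rw [Measure.map_apply_of_aemeasurable hm hs]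
  refine withDensity_absolutelyContinuous _ _ ?_
  rw [Measure.restrict_apply' (isOpen_extChartAt_target x).measurableSet]
  refine volume_absolutelyContinuous_hausdorffMeasure n ?_
  refine measure_null_of_locally_null _ fun y hy => ?_
  have hp : (extChartAt (𝓡 n) x).symm y ∈ (extChartAt (𝓡 n) x).source :=
    (extChartAt (𝓡 n) x).map_target hy.2
  obtain ⟨K, U, hU, hK⟩ := exists_lipschitzOnWith_of_contMDiffAt_normedSpace
    (contMDiffAt_extChartAt' (n := 1) (I := 𝓡 n) (by simpa using hp))
  refine ⟨(extChartAt (𝓡 n) x).symm ⁻¹' (s ∩ U) ∩ (extChartAt (𝓡 n) x).target, ?_, ?_⟩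
  · have h1 : (extChartAt (𝓡 n) x).symm ⁻¹' U ∈ 𝓝 y :=
      (continuousAt_extChartAt_symm'' hy.2).preimage_mem_nhds hU
    filter_upwards [mem_nhdsWithin_of_mem_nhds h1, self_mem_nhdsWithin] with z hz hz'
    exact ⟨⟨hz'.1, hz⟩, hz'.2⟩
  · refine measure_mono_null (t := extChartAt (𝓡 n) x '' (s ∩ U)) ?_ ?_
    · rintro z ⟨hz, hzt⟩
      exact ⟨_, hz, (extChartAt (𝓡 n) x).right_inv hzt⟩
    · refine le_antisymm ((hausdorffMeasure_image_le_pow hK inter_subset_right n).trans ?_) bot_le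
      rw [measure_mono_null inter_subset_left h0, mul_zero]

lemma riemannianVolume_absolutelyContinuous : riemannianVolume n M ≪ μH[(n : ℝ)] := by
  have h : riemannianVolume n M ≤ (⊤ : ℝ≥0∞) • μH[(n : ℝ)] :=
    iSup_le fun x => (chartVolume_absolutelyContinuous x).le_top_smul
  exact (Measure.absolutelyContinuous_of_le h).trans Measure.smul_absolutelyContinuous

lemma hausdorffMeasure_image_eq_zero [CompactSpace M] {f : M → M}
    (hf : ContMDiff (𝓡 n) (𝓡 n) 1 f) {s : Set M} (hs : μH[(n : ℝ)] s = 0) :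
    μH[(n : ℝ)] (f '' s) = 0 := by
  choose K U hU hK using fun x => exists_lipschitzOnWith_of_contMDiffAt (hf x)
  obtain ⟨t, ht⟩ := CompactSpace.elim_nhds_subcover U hU
  refine measure_mono_null (t := ⋃ x ∈ t, f '' (s ∩ U x)) ?_ ?_
  · rintro _ ⟨z, hz, rfl⟩
    obtain ⟨x, hx, hzx⟩ := mem_iUnion₂.1 (ht.symm ▸ mem_univ z : z ∈ ⋃ x ∈ t, U x)
    exact mem_iUnion₂.2 ⟨x, hx, mem_image_of_mem f ⟨hz, hzx⟩⟩
  · refine (measure_biUnion_null_iff t.countable_toSet).2 fun x _ => ?_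
    refine le_antisymm ((hausdorffMeasure_image_le_pow (hK x) inter_subset_right n).trans ?_) bot_le
    rw [measure_mono_null inter_subset_left hs, mul_zero]

/-- Lebesgue density theorem for the Hausdorff measure of the Riemannian distance. -/
lemma exists_density_point [SecondCountableTopology M] {B : Set M} (hB : MeasurableSet B)
    (hB₀ : μH[(n : ℝ)] B ≠ 0) :
    ∃ x ∈ B, ∀ ε : ℝ≥0∞, ε ≠ 0 → ∀ᶠ r : ℝ≥0 in 𝓝[>] 0,
      μH[(n : ℝ)] (eball x r \ B) ≤ ε * r ^ n := by
  have := isAddHaarMeasure_hausdorffMeasure_euclideanSpace n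
  obtain ⟨x₀, hx₀, hx₀B⟩ : ∃ x₀ ∈ B, ∀ u ∈ 𝓝[B] x₀, μH[(n : ℝ)] u ≠ 0 := by
    by_contra! h
    exact hB₀ (measure_null_of_locally_null B h)
  obtain ⟨K, U, hU, hK⟩ := exists_lipschitzOnWith_extChartAt n x₀
  obtain ⟨K', V, hV, hK'⟩ := exists_lipschitzOnWith_extChartAt_symm n x₀
  set φ := extChartAt (𝓡 n) x₀ with hφ
  obtain ⟨W, hWsub, hWo, hxW⟩ := mem_nhds_iff.1 (inter_mem (inter_mem hU
    ((continuousAt_extChartAt (I := 𝓡 n) x₀).preimage_mem_nhds hV))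
    (extChartAt_source_mem_nhds (I := 𝓡 n) x₀))
  have hWU : W ⊆ U := fun z hz => (hWsub hz).1.1
  have hWV : ∀ z ∈ W, φ z ∈ V := fun z hz => (hWsub hz).1.2
  have hWs : W ⊆ φ.source := fun z hz => (hWsub hz).2
  have himg : φ '' (W ∩ B) = φ.target ∩ φ.symm ⁻¹' (W ∩ B) := by
    ext y
    constructor
    · rintro ⟨z, hz, rfl⟩
      exact ⟨φ.map_source (hWs hz.1), by simpa only [mem_preimage, φ.left_inv (hWs hz.1)] using hz⟩
    · rintro ⟨hy, hz⟩
      exact ⟨_, hz, φ.right_inv hy⟩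
  have hmeas : MeasurableSet (φ '' (W ∩ B)) := by
    classical
    rw [himg]
    have h1 : Measurable (φ.target.piecewise φ.symm fun _ => x₀) :=
      ContinuousOn.measurable_piecewise (continuousOn_extChartAt_symm x₀) continuousOn_const
        (isOpen_extChartAt_target x₀).measurableSet
    have h2 : φ.target ∩ φ.symm ⁻¹' (W ∩ B) =
        φ.target ∩ (φ.target.piecewise φ.symm fun _ => x₀) ⁻¹' (W ∩ B) := by
      ext y
      refine and_congr_right fun hy => ?_
      simp only [mem_preimage]
      rw [piecewise_eq_of_mem _ _ _ hy]
    rw [h2]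
    exact (isOpen_extChartAt_target x₀).measurableSet.inter (h1 (hWo.measurableSet.inter hB))
  have hne : μH[(n : ℝ)] (φ '' (W ∩ B)) ≠ 0 := by
    intro h0
    refine hx₀B (W ∩ B) (inter_mem (mem_nhdsWithin_of_mem_nhds (hWo.mem_nhds hxW))
      self_mem_nhdsWithin) ?_
    have h1 : φ.symm '' (φ '' (W ∩ B)) = W ∩ B := by
      rw [image_image]
      refine (image_congr fun z hz => φ.left_inv (hWs hz.1)).trans (image_id' _)
    rw [← h1]
    have h2 : φ '' (W ∩ B) ⊆ V := by
      rintro _ ⟨z, hz, rfl⟩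
      exact hWV z hz.1
    refine le_antisymm ((hausdorffMeasure_image_le_pow hK' h2 n).trans ?_) bot_le
    rw [h0, mul_zero]
  obtain ⟨_, ⟨x, hx, rfl⟩, hlim⟩ := Measure.exists_mem_of_measure_ne_zero_of_ae hne
    (ae_restrict_of_ae (Besicovitch.ae_tendsto_measure_inter_div_of_measurableSet
      (μH[(n : ℝ)] : Measure (EuclideanSpace ℝ (Fin n))) hmeas.compl))
  rw [indicator_of_notMem (notMem_compl_iff.2 (mem_image_of_mem φ hx))] at hlim
  refine ⟨x, hx.2, fun ε hε => ?_⟩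
  let L : ℝ≥0 := K + 1
  let c : ℝ≥0∞ := μH[(n : ℝ)] (ball (0 : EuclideanSpace ℝ (Fin n)) 1)
  let Q : ℝ≥0∞ := K' ^ n * (L ^ n * c)
  have hc : c ≠ ⊤ := measure_ball_lt_top.ne
  have hQ : Q ≠ ⊤ := ENNReal.mul_ne_top (by simp) (ENNReal.mul_ne_top (by simp) hc)
  have hQ₁ : Q + 1 ≠ ⊤ := by simp [hQ]
  have hε' : 0 < ε / (Q + 1) := ENNReal.div_pos hε hQ₁
  have htend : Tendsto (fun r : ℝ≥0 => ((L * r : ℝ≥0) : ℝ)) (𝓝[>] 0) (𝓝[>] 0) := by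
    refine tendsto_nhdsWithin_iff.2 ⟨?_, ?_⟩
    · have : Continuous fun r : ℝ≥0 => ((L * r : ℝ≥0) : ℝ) := by fun_prop
      simpa using (this.tendsto 0).mono_left nhdsWithin_le_nhds
    · filter_upwards [self_mem_nhdsWithin] with r hr
      have : 0 < L * r := mul_pos (by positivity) hr
      exact_mod_cast this
  obtain ⟨R, hR, hRW⟩ := EMetric.mem_nhds_iff.1 (hWo.mem_nhds hx.1)
  have hsmall : ∀ᶠ r : ℝ≥0 in 𝓝[>] 0, (r : ℝ≥0∞) < R := by
    have : ContinuousAt (fun r : ℝ≥0 => (r : ℝ≥0∞)) 0 := ENNReal.continuous_coe.continuousAt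
    exact nhdsWithin_le_nhds (this.eventually_lt_const (by simpa using hR))
  filter_upwards [htend.eventually (hlim.eventually_lt_const hε'), hsmall, self_mem_nhdsWithin]
    with r hr hrR hr₀
  have hLr : 0 < L * r := mul_pos (by positivity) hr₀
  have hball : μH[(n : ℝ)] (closedBall (φ x) (L * r : ℝ≥0)) = L ^ n * r ^ n * c := by
    rw [Measure.addHaar_closedBall _ _ (NNReal.coe_nonneg _), finrank_euclideanSpace_fin,
      ENNReal.ofReal_pow (NNReal.coe_nonneg _), ENNReal.ofReal_coe_nnreal, ENNReal.coe_mul, mul_pow]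
  have hsub : eball x r \ B ⊆
      φ.symm '' ((φ '' (W ∩ B))ᶜ ∩ closedBall (φ x) (L * r : ℝ≥0) ∩ V) := by
    rintro z ⟨hz, hzB⟩
    have hzW : z ∈ W := hRW (eball_subset_eball hrR.le hz)
    refine ⟨φ z, ⟨⟨?_, ?_⟩, hWV z hzW⟩, φ.left_inv (hWs hzW)⟩
    · rintro ⟨w, hw, hwz⟩
      rw [φ.injOn (hWs hw.1) (hWs hzW) hwz] at hw
      exact hzB hw.2
    · have h1 := hK (hWU hzW) (hWU hx.1)
      rw [mem_closedBall, ← coe_nndist, NNReal.coe_le_coe, ← ENNReal.coe_le_coe, ← edist_nndist]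
      refine h1.trans ?_
      rw [ENNReal.coe_mul]
      gcongr
      · exact le_self_add
      · exact le_of_lt hz
  calc μH[(n : ℝ)] (eball x r \ B)
      ≤ K' ^ n * μH[(n : ℝ)] ((φ '' (W ∩ B))ᶜ ∩ closedBall (φ x) (L * r : ℝ≥0) ∩ V) :=
        (measure_mono hsub).trans (hausdorffMeasure_image_le_pow hK' inter_subset_right n)
    _ ≤ K' ^ n * (ε / (Q + 1) * μH[(n : ℝ)] (closedBall (φ x) (L * r : ℝ≥0))) := by
        gcongr
        refine (measure_mono inter_subset_left).trans ?_
        rw [← ENNReal.div_le_iff]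
        · exact hr.le
        · exact (measure_closedBall_pos _ _ (by exact_mod_cast hLr)).ne'
        · exact measure_closedBall_lt_top.ne
    _ = (ε / (Q + 1) * Q) * r ^ n := by rw [hball]; ring
    _ ≤ (ε / (Q + 1) * (Q + 1)) * r ^ n := by gcongr; exact le_self_add
    _ = ε * r ^ n := by rw [ENNReal.div_mul_cancel (by simp) hQ₁]

end HausdorffMeasure

section Ergodicity

variable {M : Type*} [EMetricSpace M] [MeasurableSpace M]

/-- An invariant set with a density point has almost full measure in a ball of fixed radius. -/
lemma exists_hausdorffMeasure_eball_diff_le [BorelSpace M] {n : ℕ}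
    {α C δ l : ℝ≥0} (hδ : 0 < δ) (hl : l < 1)
    {Γ : Subsemigroup (Function.End M)}
    (hΓ : ∀ k : ℕ, ∀ x : M, ∃ f ∈ Γ, ∃ g : M → M, ∃ Λ : ℝ≥0,
      IsInverseBranch α C δ Λ f g x ∧ 1 ≤ l ^ k * Λ)
    {A B : Set M} (hBA : B ⊆ A) (hA : ∀ f ∈ Γ, (f : M → M) '' A ⊆ A) {x : M}
    (hx : ∀ ε : ℝ≥0∞, ε ≠ 0 → ∀ᶠ r : ℝ≥0 in 𝓝[>] 0, μH[(n : ℝ)] (eball x r \ B) ≤ ε * r ^ n)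
    {ε : ℝ≥0∞} (hε : ε ≠ 0) : ∃ y : M, μH[(n : ℝ)] (eball y δ \ A) ≤ ε := by
  set D := distortion α C δ with hD
  have hD₀ : 0 < D := by
    rw [hD, ← NNReal.coe_pos, coe_distortion]
    exact Real.exp_pos _
  have hQ : (((D * D * δ) ^ n : ℝ≥0) : ℝ≥0∞) ≠ 0 := by
    have : 0 < (D * D * δ) ^ n := by positivity
    exact_mod_cast this.ne'
  have hev := hx (ε / ((D * D * δ) ^ n : ℝ≥0)) (ENNReal.div_pos hε ENNReal.coe_ne_top).ne'
  obtain ⟨u, hu, hsub⟩ := mem_nhdsGT_iff_exists_Ioo_subset.1 hev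
  have hu : 0 < u := hu
  obtain ⟨k, hk⟩ : ∃ k : ℕ, l ^ k < u / (D * δ) :=
    exists_pow_lt_of_lt_one (div_pos hu (mul_pos hD₀ hδ)) hl
  obtain ⟨f, hf, g, Λ, hb, hΛ⟩ := hΓ k x
  have hΛ₀ : 0 < Λ := by
    rcases (zero_le : 0 ≤ Λ).eq_or_lt with h | h
    · simp [← h] at hΛ
    · exact h
  have hΛk : Λ⁻¹ ≤ l ^ k := by
    rw [inv_le_iff_one_le_mul₀ hΛ₀]
    exact hΛ
  set r : ℝ≥0 := Λ⁻¹ * D * δ with hr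
  have hr₀ : 0 < r := by positivity
  have hru : r < u := by
    calc r = Λ⁻¹ * (D * δ) := by rw [hr, mul_assoc]
      _ ≤ l ^ k * (D * δ) := by gcongr
      _ < u := by rwa [lt_div_iff₀ (mul_pos hD₀ hδ)] at hk
  have hden : μH[(n : ℝ)] (eball x r \ B) ≤ ε / ((D * D * δ) ^ n : ℝ≥0) * r ^ n := hsub ⟨hr₀, hru⟩
  refine ⟨f x, ?_⟩
  have hcov : eball (f x) δ \ A ⊆ f '' ((eball x r \ B) ∩ g '' eball (f x) δ) := by
    rintro z ⟨hz, hzA⟩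
    have hfg := hb.right_inv z hz
    refine ⟨g z, ⟨⟨?_, fun hgB => hzA ?_⟩, mem_image_of_mem g hz⟩, hfg⟩
    · rw [mem_eball] at hz ⊢
      refine (hb.edist_le δ le_rfl z hz).trans_lt ?_
      rw [hr, ENNReal.coe_mul (Λ⁻¹ * D)]
      have : 0 < Λ⁻¹ * D := by positivity
      exact ENNReal.mul_lt_mul_right (by exact_mod_cast this.ne') ENNReal.coe_ne_top hz
    · rw [← hfg]
      exact hA f hf (mem_image_of_mem _ (hBA hgB))
  calc μH[(n : ℝ)] (eball (f x) δ \ A)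
      ≤ ((Λ * D : ℝ≥0) : ℝ≥0∞) ^ n * μH[(n : ℝ)] ((eball x r \ B) ∩ g '' eball (f x) δ) :=
        (measure_mono hcov).trans
          (hausdorffMeasure_image_le_pow (hb.lipschitzOnWith δ le_rfl) inter_subset_right n)
    _ ≤ ((Λ * D : ℝ≥0) : ℝ≥0∞) ^ n * (ε / ((D * D * δ) ^ n : ℝ≥0) * r ^ n) := by
        gcongr
        exact (measure_mono inter_subset_left).trans hden
    _ = ε / ((D * D * δ) ^ n : ℝ≥0) * ((Λ * D * r) ^ n : ℝ≥0) := by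
        push_cast
        ring
    _ = ε := by
        have : Λ * D * r = D * D * δ := by
          rw [hr]
          field_simp
        rw [this, ENNReal.div_mul_cancel hQ ENNReal.coe_ne_top]

/-- If a set has almost full measure in balls of a fixed radius, it has full measure in a ball. -/
lemma exists_eball_diff_null [CompactSpace M] {μ : Measure M} {δ : ℝ≥0} (hδ : 0 < δ) {A : Set M}
    (h : ∀ ε : ℝ≥0∞, ε ≠ 0 → ∃ y : M, μ (eball y δ \ A) ≤ ε) :
    ∃ y : M, μ (eball y (δ / 2) \ A) = 0 := by
  choose y hy using fun m : ℕ => h (m : ℝ≥0∞)⁻¹ (by simp)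
  obtain ⟨p, ψ, hψ, hp⟩ := CompactSpace.tendsto_subseq y
  refine ⟨p, le_antisymm ?_ bot_le⟩
  have hδ2 : (0 : ℝ≥0∞) < δ / 2 := ENNReal.div_pos (by exact_mod_cast hδ.ne') (by simp)
  have hlim : Tendsto (fun m => ((ψ m : ℕ) : ℝ≥0∞)⁻¹) atTop (𝓝 0) :=
    ENNReal.tendsto_inv_nat_nhds_zero.comp hψ.tendsto_atTop
  refine ge_of_tendsto hlim ?_
  filter_upwards [hp.eventually (eball_mem_nhds p hδ2)] with m hm
  refine (measure_mono (sdiff_subset_sdiff_left fun z hz => ?_)).trans (hy (ψ m))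
  have hm' : edist (y (ψ m)) p < δ / 2 := hm
  calc edist z (y (ψ m)) ≤ edist z p + edist (y (ψ m)) p := edist_triangle_right _ _ _
    _ < δ / 2 + δ / 2 := ENNReal.add_lt_add hz hm'
    _ = δ := ENNReal.add_halves _

variable {n : ℕ} [ChartedSpace (EuclideanSpace ℝ (Fin n)) M]
  [IsManifold (𝓡 n) ∞ M] [RiemannianBundle (fun x : M => TangentSpace (𝓡 n) x)]
  [IsContinuousRiemannianBundle (EuclideanSpace ℝ (Fin n)) (fun x : M => TangentSpace (𝓡 n) x)]
  [IsRiemannianManifold (𝓡 n) M] [BorelSpace M] [CompactSpace M]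

/-- An invariant set of positive volume has full Hausdorff measure. -/
lemma hausdorffMeasure_compl_eq_zero {α : ℝ≥0} (hα : 0 < α) {Γ : Subsemigroup (Function.End M)}
    (hexp : ∀ x : M, ∃ f ∈ Γ, ∃ a : M → ℝ, IsHolderConformal n α f a ∧ 1 < a x)
    (hsm : ∀ f ∈ Γ, ContMDiff (𝓡 n) (𝓡 n) 1 (f : M → M)) (hmin : BackwardMinimal Γ)
    {A B : Set M} (hB : MeasurableSet B) (hBA : B ⊆ A) (hA : ∀ f ∈ Γ, (f : M → M) '' A ⊆ A)
    (hB₀ : μH[(n : ℝ)] B ≠ 0) : μH[(n : ℝ)] Aᶜ = 0 := by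
  have : SecondCountableTopology M := EMetric.secondCountable_of_sigmaCompact M
  obtain ⟨δ, C, l, hδ, hl₀, hl, hbr⟩ := exists_uniform_isInverseBranch hα hexp
  obtain ⟨C', hC'⟩ := exists_isInverseBranch_iterate hα hl₀ hl hbr
  obtain ⟨x, -, hx⟩ := exists_density_point hB hB₀
  obtain ⟨y, hy⟩ := exists_eball_diff_null hδ fun ε hε =>
    exists_hausdorffMeasure_eball_diff_le hδ hl hC' hBA hA hx hε
  obtain ⟨F, hF, hFΓ, hcov⟩ := hmin (eball y (δ / 2)) isOpen_eball
    ⟨y, mem_eball_self (ENNReal.div_pos (by exact_mod_cast hδ.ne') (by simp))⟩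
  refine measure_mono_null (t := ⋃ h ∈ F, (h : M → M) '' (eball y (δ / 2) \ A)) ?_ ?_
  · intro z hz
    obtain ⟨h, hh, w, hw, rfl⟩ := mem_iUnion₂.1 (hcov.symm ▸ mem_univ z :
      z ∈ ⋃ h ∈ F, (h : M → M) '' eball y (δ / 2))
    refine mem_iUnion₂.2 ⟨h, hh, mem_image_of_mem _ ⟨hw, fun hwA => hz ?_⟩⟩
    exact hA h (hFΓ h hh) (mem_image_of_mem _ hwA)
  · exact (measure_biUnion_null_iff hF.countable).2 fun h hh =>
      hausdorffMeasure_image_eq_zero (hsm h (hFΓ h hh)) hy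

end Ergodicity

section Lebesgue

variable {n : ℕ} {M : Type*} [TopologicalSpace M] [ChartedSpace (EuclideanSpace ℝ (Fin n)) M]

lemma isOpen_singleton_of_dim_eq_zero (hn : n = 0) (x : M) : IsOpen ({x} : Set M) := by
  subst hn
  have : (chartAt (EuclideanSpace ℝ (Fin 0)) x).source = {x} := by
    refine Subset.antisymm (fun z hz => ?_) (by simp)
    exact (chartAt (EuclideanSpace ℝ (Fin 0)) x).injOn hz (mem_chart_source _ x)
      (Subsingleton.elim _ _)
  rw [← this]
  exact (chartAt (EuclideanSpace ℝ (Fin 0)) x).open_source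

variable [RiemannianBundle (fun x : M => TangentSpace (𝓡 n) x)] [MeasurableSpace M]

lemma lebesgue_eq_one {A : Set M} (hA : lebesgue n M A ≠ 0) (hAc : lebesgue n M Aᶜ = 0) :
    lebesgue n M A = 1 := by
  have h0 : riemannianVolume n M univ ≠ 0 := fun h => by
    apply hA
    rw [lebesgue, Measure.measure_univ_eq_zero.1 h, smul_zero]
    rfl
  have htop : riemannianVolume n M univ ≠ ⊤ := fun h => by
    apply hA
    rw [lebesgue, h, ENNReal.inv_top, zero_smul]
    rfl
  have huniv : lebesgue n M univ = 1 := by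
    rw [lebesgue, Measure.smul_apply, smul_eq_mul, ENNReal.inv_mul_cancel h0 htop]
  refine le_antisymm ((measure_mono (subset_univ A)).trans_eq huniv) ?_
  rw [← huniv, ← union_compl_self A]
  exact (measure_union_le _ _).trans_eq (by rw [hAc, add_zero])

end Lebesgue

section Main

variable {n : ℕ} {M : Type*} [EMetricSpace M] [ChartedSpace (EuclideanSpace ℝ (Fin n)) M]
  [RiemannianBundle (fun x : M => TangentSpace (𝓡 n) x)]

lemma IsHolderConformal.one_lt {α : ℝ≥0} (hn : n ≠ 0) {f : M → M} {a : M → ℝ}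
    (hf : IsHolderConformal n α f a) {x : M}
    (hx : ‖(mfderiv (𝓡 n) (𝓡 n) f x).inverse‖ < 1) : 1 < a x := by
  obtain ⟨v, hv⟩ : ∃ v : TangentSpace (𝓡 n) x, v ≠ 0 := by
    obtain ⟨v, hv⟩ : ∃ v : EuclideanSpace ℝ (Fin n), v ≠ 0 :=
      ⟨EuclideanSpace.single ⟨0, Nat.pos_of_ne_zero hn⟩ 1, by simp⟩
    exact ⟨v, hv⟩
  have hv' := norm_pos_iff.2 hv
  have h1 : (mfderiv (𝓡 n) (𝓡 n) f x).inverse (mfderiv (𝓡 n) (𝓡 n) f x v) = v := by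
    have := (hf.localDiffeo x).mfderivToContinuousLinearEquiv_coe one_ne_zero
    rw [← this, ContinuousLinearMap.inverse_equiv]
    exact ContinuousLinearEquiv.symm_apply_apply _ v
  have h2 := (mfderiv (𝓡 n) (𝓡 n) f x).inverse.le_opNorm (mfderiv (𝓡 n) (𝓡 n) f x v)
  rw [h1, hf.norm_mfderiv] at h2
  by_contra! h
  have h3 : ‖(mfderiv (𝓡 n) (𝓡 n) f x).inverse‖ * (a x * ‖v‖) < 1 * (1 * ‖v‖) := by
    have := hf.pos x
    calc _ < 1 * (a x * ‖v‖) := by gcongr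
      _ ≤ _ := by gcongr
  linarith

variable [IsManifold (𝓡 n) ∞ M]
  [IsContinuousRiemannianBundle (EuclideanSpace ℝ (Fin n)) (fun x : M => TangentSpace (𝓡 n) x)]
  [IsContMDiffRiemannianBundle (𝓡 n) ∞ (EuclideanSpace ℝ (Fin n))
      (fun x : M => TangentSpace (𝓡 n) x)]
  [IsRiemannianManifold (𝓡 n) M] [MeasurableSpace M] [BorelSpace M] [CompactSpace M]

/-- Ergodicity of backward expanding and backward minimal semigroups of conformal maps, for
manifolds equipped with the Riemannian distance. -/
theorem lebesgueErgodic_of_isRiemannianManifold (hn : n ≠ 0) {α : ℝ≥0} (hα₀ : 0 < α) (hα₁ : α ≤ 1)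
    {S : Set (Function.End M)} (hS : ∀ f ∈ S, IsHolderLocalDiffeo n α f)
    (hconf : ∀ f ∈ S, IsConformal n f) (hexp : BackwardExpanding n (Subsemigroup.closure S))
    (hmin : BackwardMinimal (Subsemigroup.closure S)) :
    LebesgueErgodic n (Subsemigroup.closure S) := by
  have hΓ : ∀ f ∈ Subsemigroup.closure S, ∃ a, IsHolderConformal n α f a := by
    intro f hf
    induction hf using Subsemigroup.closure_induction with
    | mem f hf => exact (hS f hf).exists_isHolderConformal hα₀ hα₁ hn (hconf f hf)
    | mul f g _ _ hf hg =>
      obtain ⟨a, ha⟩ := hf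
      obtain ⟨b, hb⟩ := hg
      exact ⟨_, ha.comp hb⟩
  intro A hA hinv
  refine or_iff_not_imp_left.2 fun hA₀ => lebesgue_eq_one hA₀ ?_
  have hac : lebesgue n M ≪ μH[(n : ℝ)] :=
    Measure.smul_absolutelyContinuous.trans riemannianVolume_absolutelyContinuous
  obtain ⟨B, hBA, hB, hBeq⟩ := hA.exists_measurable_subset_ae_eq
  refine hac (hausdorffMeasure_compl_eq_zero hα₀ (fun x => ?_) (fun f hf => ?_) hmin hB hBA hinv
    fun h => hA₀ ?_)
  · obtain ⟨f, hf, hfx⟩ := hexp x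
    obtain ⟨a, ha⟩ := hΓ f hf
    exact ⟨f, hf, a, ha, ha.one_lt hn hfx⟩
  · obtain ⟨a, ha⟩ := hΓ f hf
    exact ha.localDiffeo.contMDiff
  · rw [← measure_congr hBeq]
    exact hac h

end Main

end ExpandingActions

theorem mainTheorem6 {n : ℕ} {M : Type*} [TopologicalSpace M] [T2Space M] [CompactSpace M]
    [ChartedSpace (EuclideanSpace ℝ (Fin n)) M] [IsManifold (𝓡 n) ∞ M]
    [RiemannianBundle (fun x : M => TangentSpace (𝓡 n) x)]
    [IsContMDiffRiemannianBundle (𝓡 n) ∞ (EuclideanSpace ℝ (Fin n))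
      (fun x : M => TangentSpace (𝓡 n) x)]
    [MeasurableSpace M] [BorelSpace M]
    (α : ℝ≥0) (hα₀ : 0 < α) (hα₁ : α ≤ 1)
    (S : Set (Function.End M))
    (hS : ∀ f ∈ S, ExpandingActions.IsHolderLocalDiffeo n α f)
    (hconf : ∀ f ∈ S, ExpandingActions.IsConformal n f)
    (hexp : ExpandingActions.BackwardExpanding n (Subsemigroup.closure S))
    (hmin : ExpandingActions.BackwardMinimal (Subsemigroup.closure S)) :
    ExpandingActions.LebesgueErgodic n (Subsemigroup.closure S) := by
  by_cases hn : n = 0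
  · intro A _ hinv
    refine or_iff_not_imp_left.2 fun hA₀ => ExpandingActions.lebesgue_eq_one hA₀ ?_
    obtain ⟨x, hx⟩ := nonempty_of_measure_ne_zero hA₀
    obtain ⟨F, -, hF, hcov⟩ :=
      hmin {x} (ExpandingActions.isOpen_singleton_of_dim_eq_zero hn x) (singleton_nonempty x)
    have hA : A = univ := by
      refine eq_univ_of_univ_subset ?_
      rw [← hcov]
      refine iUnion₂_subset fun h hh => ?_
      exact (image_mono (singleton_subset_iff.2 hx)).trans (hinv h (hF h hh))
    rw [hA, compl_univ, measure_empty]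
  · have : IsContinuousRiemannianBundle (EuclideanSpace ℝ (Fin n))
        (fun x : M => TangentSpace (𝓡 n) x) := by
      obtain ⟨g, hg, hg'⟩ := IsContMDiffRiemannianBundle.exists_contMDiff (IB := 𝓡 n) (n := ∞)
        (F := EuclideanSpace ℝ (Fin n)) (E := fun x : M => TangentSpace (𝓡 n) x)
      exact ⟨g, hg.continuous, hg'⟩
    let : EMetricSpace M := EMetricSpace.ofRiemannianMetric (𝓡 n) M
    have : IsRiemannianManifold (𝓡 n) M := ⟨fun x y => rfl⟩
    exact ExpandingActions.lebesgueErgodic_of_isRiemannianManifold hn hα₀ hα₁ hS hconf hexp hmin
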